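/- **Setting.** Let $d\ge 2$ and let $X_1,\dots,X_{d-1},Y$ be the axes of $\mathbb R^d$. A set $P$ of $n$ points is *well-distributed with constant* $\varepsilon_d>0$ if (i) $P\subset[0,1]^d$; (ii) every axis-parallel rectangle containing $k\ge2$ points of $P$ has volume at least $\varepsilon_d k/n$; (iii) every rectangle of volume $v>0$ contains at most $\lceil vn/\varepsilon_d\rceil$ points of $P$ and, if it lies in $[0,1]^d$, at least $\lfloor \varepsilon_d v n\rfloor$ points of $P$. A *data structure* on $P$ is a finite family of non-empty subsets of $P$ ("sums"); $S^+\ge 1$ is the number of its sums that are not singletons. For a sum $s$, its *$X_i$-range* is the smallest interval containing the $X_i$-coordinates of its points, and $b(s)$ is the smallest box unbounded from below along $Y$ that contains $s$. For $1\le i\le d-1$ let $T_i$ be the complete binary tree of height $h=\lfloor\log_2 n\rfloor+1$ whose nodes of depth $a$ correspond to the $2^a$ dyadic slabs $r(v)=\{m2^{-a}\le X_i<(m+1)2^{-a}\}$ of the cube. The hyperplane $\ell(v)$ halves $r(v)$ perpendicularly to $X_i$, and a point on it counts as being to its right. A sum $s$ is *placed* in $T_i$ at the highest inner node $w$ such that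 $s$ has points on both sides of $\ell(w)$; if there is none, at the leaf $w$ with $s\subset r(w)$. (Points with $X_i=1$ lie in no slab and, almost surely, in no query; if a sum with such a point is thereby placed nowhere, put $e(s)=\emptyset$ below.) **Random query.** Choose $(x_i,z_i)\in[0,1]^2$, $1\le i\le d-1$, and $y\in[0,1]$ independently and uniformly. Let $\ell_i=\lfloor(1-z_i)h\rfloor$, let $v_i$ be the node of $T_i$ at depth $\ell_i$ whose slab contains $x_i$, and let $x_i'$ be the left end of that slab. The query is $q=[x_1',x_1]\times\dots\times[x_{d-1}',x_{d-1}]\times(-\infty,y]$. **Subproblem, top, extensions.** Let $\mathfrak j=(j_1,\dots,j_{d-1})$ be positive integers. The $\mathfrak j$-subproblem is *well-defined* if for every $i$ there is a node $u_i$ of $T_i$ of depth $\ell_i+j_i\le h$ that has a right sibling whose slab contains $x_i$; then $u_i$ is unique, and the subproblem is to cover the points of $P$ in $r(u_1)\cap\dots\cap r(u_{d-1})$ with $Y$-coordinate at most $y$. For $\delta>0$ put $$\lambda=\frac{\delta h^{d-1}}{j_1\cdots j_{d-1}}\cdot\frac{n}{S^+}.$$ The *$\lambda$-top* $\mathrm{Top}$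 is the set of points of $P$ in $r(u_1)\cap\dots\cap r(u_{d-1})\cap\{y-\beta\le Y\le y\}$, where $\beta\ge0$ is chosen such that there are exactly $\lceil\lambda\rceil$ of them; it is well-defined if such a $\beta$ exists. For a sum $s$, the *extension* $e(s)$ is the box unbounded from below along $Y$, with the same top boundary as $b(s)$, whose $X_i$-range is as follows, where $w_i$ is the node of $T_i$ at which $s$ is placed: if $w_i$ is in the subtree of $u_i$, it is that of $r(w_i)$; otherwise it is the smallest interval containing the $X_i$-ranges of $s$ and of $r(u_i)$. Let $\mathbf S_{\mathfrak j}$ be the set of the sums $s$ of the data structure that are contained in $q$, for which $b(s)$ contains a point of $P$ that belongs to the subproblem, and for which $|e(s)\cap\mathrm{Top}|\ge C$. **Main Lemma.** For every $d\ge 2$ there is $K>0$, for every $\alpha>0$ there is $c>0$ (depending on $d,\alpha$), and for every $\varepsilon_d>0$ there is $C_0$ such that for all integers $C\ge C_0$ and all real $C'>0$ there are $\delta_0>0$ and $n_0$ with the following property. Let $0<\delta\le\delta_0$, let $P$ be a set of $n\ge n_0$ points that is well-distributed with constant $\varepsilon_d$, consider any data structure on $P$ with $S^+\ge1$, and let $\mathfrak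 j$ be such that $1\le j_i\le h/2$ for all $i$ and $$\lceil\lambda\rceil\cdot 2^{j_1+\dots+j_{d-1}}\le n^{1-\alpha}.$$ Then: 1. With probability at least $c$, the $\mathfrak j$-subproblem and its $\lambda$-top are well-defined. 2. Conditioned on both being well-defined, with probability at least $1-K\sqrt{\delta/\varepsilon_d}$ the points $(x_i,z_i)$, which determine the nodes $v_i$ and $u_i$, are such that $$\mathbb E_{y}\Big[\sum_{s\in\mathbf S_{\mathfrak j}}|e(s)\cap\mathrm{Top}|\Big]<\frac{|\mathrm{Top}|}{C'},$$ where the expectation is over the random choice of $y$, conditioned on the $\lambda$-top being well-defined. -/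

import Mathlib

open MeasureTheory ProbabilityTheory
open scoped BigOperators ENNReal

noncomputable section

namespace RangeLB

/-- A point of `ℝ^d` with `d = k + 1`: its coordinates `X_1, …, X_k` and its coordinate `Y`. -/
abbrev Pt (k : ℕ) : Type := (Fin k → ℝ) × ℝ

/-- The axis-parallel rectangle with lowest corner `a` and highest corner `b`. -/
def rect {k : ℕ} (a b : Pt k) : Set (Pt k) :=
  {p | (∀ i, a.1 i ≤ p.1 i ∧ p.1 i ≤ b.1 i) ∧ a.2 ≤ p.2 ∧ p.2 ≤ b.2}

/-- The volume of `rect a b`, when `a ≤ b`. -/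
def rectVol {k : ℕ} (a b : Pt k) : ℝ := (∏ i, (b.1 i - a.1 i)) * (b.2 - a.2)

open Classical in
/-- The points of `P` in a region. -/
def pointsIn {k : ℕ} (P : Finset (Pt k)) (R : Set (Pt k)) : Finset (Pt k) :=
  P.filter (fun p => p ∈ R)

theorem mem_pointsIn {k : ℕ} {P : Finset (Pt k)} {R : Set (Pt k)} {p : Pt k} :
    p ∈ pointsIn P R ↔ p ∈ P ∧ p ∈ R := by
  classical
  rw [pointsIn, Finset.mem_filter]

/-- The unit cube. -/
def unitCube (k : ℕ) : Set (Pt k) := rect (fun _ => 0, 0) (fun _ => 1, 1)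

/-- `P` is well-distributed with constant `ε`: up to the factor `ε`, the number of points in a
rectangle is its volume times `|P|`. Only rectangles with non-empty interior are tested; a
degenerate rectangle is a limit of those, so in particular no two points of `P` agree in a
coordinate. -/
structure WellDistributed {k : ℕ} (ε : ℝ) (P : Finset (Pt k)) : Prop where
  subset_cube : ∀ p ∈ P, p ∈ unitCube k
  le_vol : ∀ a b : Pt k, (∀ i, a.1 i < b.1 i) → a.2 < b.2 →
    2 ≤ (pointsIn P (rect a b)).card →
      ε * (pointsIn P (rect a b)).card / P.card ≤ rectVol a b
  card_le : ∀ a b : Pt k, (∀ i, a.1 i < b.1 i) → a.2 < b.2 →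
    (pointsIn P (rect a b)).card ≤ ⌈rectVol a b * P.card / ε⌉₊
  le_card : ∀ a b : Pt k, (∀ i, a.1 i < b.1 i) → a.2 < b.2 →
    a ∈ unitCube k → b ∈ unitCube k →
      ⌊ε * rectVol a b * P.card⌋₊ ≤ (pointsIn P (rect a b)).card

/-- The common height of the trees: a box is halved unless its volume is less than `1 / n`, so
`h` is the least depth with `2 ^ (-h) < 1 / n`. -/
def height (n : ℕ) : ℕ := Nat.log 2 n + 1

/-- A node of one of the trees `T_i`: the `idx`-th from the left among the nodes of depth `depth`,
counted from `0`. -/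
@[ext] structure Node where
  depth : ℕ
  idx : ℕ

namespace Node

/-- The node belongs to the complete binary tree of height `h`. -/
def InTree (h : ℕ) (v : Node) : Prop := v.depth ≤ h ∧ v.idx < 2 ^ v.depth

/-- The left boundary of the box `r(v)` along `X_i`. -/
def left (v : Node) : ℝ := v.idx / 2 ^ v.depth

/-- The position along `X_i` of the hyperplane `ℓ(v)` that halves `r(v)`. -/
def mid (v : Node) : ℝ := (2 * v.idx + 1) / 2 ^ (v.depth + 1)

/-- The projection of the box `r(v)` to the axis `X_i` (in the other axes `r(v)` is all of the
unit cube). A point on a cutting hyperplane belongs to the right-hand box. -/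
def cell (v : Node) : Set ℝ := Set.Ico v.left ((v.idx + 1) / 2 ^ v.depth)

/-- The region `γ(v)` of `v` in the representative diagram: the unit square is cut into `h`
horizontal strips of equal height, the topmost for the root, the next for depth `1`, and so on. -/
def region (h : ℕ) (v : Node) : Set (ℝ × ℝ) :=
  v.cell ×ˢ Set.Ioc (1 - (v.depth + 1 : ℝ) / h) (1 - (v.depth : ℝ) / h)

/-- The node whose region contains `(x, z)`; see `nodeAt_eq_iff`. -/
def nodeAt (h : ℕ) (x z : ℝ) : Node where
  depth := ⌊(1 - z) * h⌋₊
  idx := ⌊x * 2 ^ ⌊(1 - z) * h⌋₊⌋₊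

theorem nodeAt_eq_iff {h : ℕ} (hh : 0 < h) {x z : ℝ} (hx : 0 ≤ x) (hz : z ≤ 1) (v : Node) :
    nodeAt h x z = v ↔ (x, z) ∈ v.region h := by
  have hR : (0 : ℝ) < h := by exact_mod_cast hh
  have e1 : ⌊(1 - z) * h⌋₊ = v.depth ↔ z ∈ Set.Ioc (1 - (v.depth + 1 : ℝ) / h)
      (1 - (v.depth : ℝ) / h) := by
    rw [Nat.floor_eq_iff (mul_nonneg (by linarith) hR.le), Set.mem_Ioc, sub_lt_comm,
      lt_div_iff₀ hR, le_sub_comm, div_le_iff₀ hR]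
    tauto
  have e2 : ⌊x * 2 ^ v.depth⌋₊ = v.idx ↔ x ∈ v.cell := by
    have h2 : (0 : ℝ) < 2 ^ v.depth := by positivity
    rw [Nat.floor_eq_iff (mul_nonneg hx h2.le), cell, left, Set.mem_Ico, div_le_iff₀ h2,
      lt_div_iff₀ h2]
  rw [region, Set.mem_prod, ← e1, ← e2, Node.ext_iff]
  simp only [nodeAt]
  constructor
  · rintro ⟨a, b⟩
    rw [a] at b
    exact ⟨b, a⟩
  · rintro ⟨b, a⟩
    refine ⟨a, ?_⟩
    rw [a]
    exact b

end Node

/-- The stored sums of a data structure on `P`, each identified with the non-empty set of points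
that it adds up. -/
structure SumFamily {k : ℕ} (P : Finset (Pt k)) where
  sums : Finset (Finset (Pt k))
  subset : ∀ s ∈ sums, s ⊆ P
  nonempty : ∀ s ∈ sums, s.Nonempty

/-- The storage `S⁺`: the number of stored sums that are not singletons. -/
def SumFamily.storage {k : ℕ} {P : Finset (Pt k)} (D : SumFamily P) : ℕ :=
  (D.sums.filter (fun s => s.card ≠ 1)).card

section Sums

variable {k : ℕ}

/-- The `X_i`-range of a sum: the projection of its `i`-th marker to `X_i`. -/
def xRange (s : Finset (Pt k)) (i : Fin k) : Set ℝ :=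
  {t | ∃ p ∈ s, ∃ q ∈ s, p.1 i ≤ t ∧ t ≤ q.1 i}

/-- `b(s)`: the smallest box that is unbounded from below along `Y` and contains `s`. -/
def sumBox (s : Finset (Pt k)) : Set (Pt k) :=
  {p | (∀ i, p.1 i ∈ xRange s i) ∧ ∃ r ∈ s, p.2 ≤ r.2}

/-- The `i`-th marker of `s` crosses the hyperplane `ℓ(v)` of the inner node `v` of `T_i`. -/
def Crosses (h : ℕ) (s : Finset (Pt k)) (i : Fin k) (v : Node) : Prop :=
  v.InTree h ∧ v.depth < h ∧ ∃ p ∈ s, ∃ q ∈ s, p.1 i < v.mid ∧ v.mid ≤ q.1 i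

/-- `s` is placed at the node `w` of `T_i`: `w` is the highest node whose hyperplane the `i`-th
marker crosses or, if there is none, `w` is the leaf whose box contains the marker. -/
def PlacedAt (h : ℕ) (s : Finset (Pt k)) (i : Fin k) (w : Node) : Prop :=
  (Crosses h s i w ∧ ∀ v, Crosses h s i v → w.depth ≤ v.depth) ∨
  ((∀ v, ¬ Crosses h s i v) ∧ w.InTree h ∧ w.depth = h ∧ xRange s i ⊆ w.cell)

open Classical in
/-- The `X_i`-range of the extension `e(s)` with respect to the defining node `u` in `T_i`. If `s`
is placed at a node `w` in the subtree of `u`, it is extended to the range of `r(w)`; otherwise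
it is extended so as to include the range of `r(u)`. -/
def extRange (h : ℕ) (s : Finset (Pt k)) (i : Fin k) (u : Node) : Set ℝ :=
  {t | ∃ w, PlacedAt h s i w ∧
    if w.cell ⊆ u.cell then t ∈ w.cell
    else ∃ a ∈ xRange s i ∪ u.cell, ∃ b ∈ xRange s i ∪ u.cell, a ≤ t ∧ t ≤ b}

/-- The extension `e(s)` with respect to the defining nodes `u`. -/
def ext (h : ℕ) (s : Finset (Pt k)) (u : Fin k → Node) : Set (Pt k) :=
  {p | (∀ i, p.1 i ∈ extRange h s i (u i)) ∧ ∃ r ∈ s, p.2 ≤ r.2}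

end Sums

section Query

variable {k : ℕ}

/-- The query `[x'_1, x_1] × ⋯ × [x'_k, x_k] × (-∞, y]` given by the points `ω i = (x_i, z_i)` of
the representative diagrams and by `y`; here `x'_i` is the left boundary of `γ(v_i)`, where `v_i`
is the node with `(x_i, z_i) ∈ γ(v_i)`. -/
def query (h : ℕ) (ω : Fin k → ℝ × ℝ) (y : ℝ) : Set (Pt k) :=
  {p | (∀ i, (Node.nodeAt h (ω i).1 (ω i).2).left ≤ p.1 i ∧ p.1 i ≤ (ω i).1) ∧ p.2 ≤ y}

/-- `u` is the tuple of defining nodes of the `j`-subproblem: `u i` is a node of `T_i` whose depth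
is `j i` plus that of `v_i`, and `u i` has a right sibling (so it is a left child, i.e. its index is
even) whose box contains the query point. The `j`-subproblem is well-defined if there is such
a `u`. -/
def IsDefining (h : ℕ) (j : Fin k → ℕ) (ω : Fin k → ℝ × ℝ) (u : Fin k → Node) : Prop :=
  ∀ i, (u i).InTree h ∧
    (u i).depth = (Node.nodeAt h (ω i).1 (ω i).2).depth + j i ∧
    Even (u i).idx ∧
    (Node.mk (u i).depth ((u i).idx + 1)).InTree h ∧
    (ω i).1 ∈ (Node.mk (u i).depth ((u i).idx + 1)).cell

/-- The region `r(u_1) ∩ ⋯ ∩ r(u_k)` cut off at height `y`. -/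
def subregion (u : Fin k → Node) (y : ℝ) : Set (Pt k) :=
  {p | (∀ i, p.1 i ∈ (u i).cell) ∧ p.2 ≤ y}

/-- The part of the `subregion` with `Y`-coordinate in `[y - β, y]`. -/
def topBox (u : Fin k → Node) (y β : ℝ) : Set (Pt k) :=
  {p | (∀ i, p.1 i ∈ (u i).cell) ∧ y - β ≤ p.2 ∧ p.2 ≤ y}

/-- The `m`-top is well-defined: for some `β` the top box contains exactly `m` points of `P`. -/
def TopDefined (P : Finset (Pt k)) (u : Fin k → Node) (y : ℝ) (m : ℕ) : Prop :=
  ∃ β : ℝ, 0 ≤ β ∧ (pointsIn P (topBox u y β)).card = m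

open Classical in
/-- The set of points in the `m`-top (empty if it is undefined). Top boxes are nested, so it does
not depend on the choice of `β`. -/
def topSet (P : Finset (Pt k)) (u : Fin k → Node) (y : ℝ) (m : ℕ) : Finset (Pt k) :=
  if H : TopDefined P u y m then pointsIn P (topBox u y H.choose) else ∅

theorem topSet_eq (P : Finset (Pt k)) (u : Fin k → Node) (y : ℝ) (m : ℕ) (β : ℝ)
    (hβ : 0 ≤ β) (hm : (pointsIn P (topBox u y β)).card = m) :
    topSet P u y m = pointsIn P (topBox u y β) := by
  have H : TopDefined P u y m := ⟨β, hβ, hm⟩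
  have mono : ∀ β₁ β₂ : ℝ, β₁ ≤ β₂ →
      pointsIn P (topBox u y β₁) ⊆ pointsIn P (topBox u y β₂) := by
    intro β₁ β₂ hle p hp
    obtain ⟨hP, hc, hl, hu⟩ := mem_pointsIn.mp hp
    exact mem_pointsIn.mpr ⟨hP, hc, by linarith, hu⟩
  rw [topSet, dif_pos H]
  rcases le_total H.choose β with hle | hle
  · exact Finset.eq_of_subset_of_card_le (mono _ _ hle) (by rw [hm, H.choose_spec.2])
  · exact (Finset.eq_of_subset_of_card_le (mono _ _ hle) (by rw [hm, H.choose_spec.2])).symm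

open Classical in
/-- The set `S_j`: the stored sums `s` that can be used for the `j`-subproblem (`s` lies inside the
query, and `s` together with the points of `P` in its box contains a point of the subproblem) and
whose extension covers at least `C` points of the `m`-top. -/
def coveringSums {P : Finset (Pt k)} (D : SumFamily P) (h m C : ℕ) (ω : Fin k → ℝ × ℝ) (y : ℝ)
    (u : Fin k → Node) : Finset (Finset (Pt k)) :=
  D.sums.filter (fun s =>
    (∀ p ∈ s, p ∈ query h ω y) ∧
    (∃ p ∈ P, p ∈ sumBox s ∧ p ∈ subregion u y) ∧
    C ≤ (pointsIn (topSet P u y m) (ext h s u)).card)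

/-- The total coverage of the `m`-top by the extensions of the sums in `S_j`. -/
def coverage {P : Finset (Pt k)} (D : SumFamily P) (h m C : ℕ) (ω : Fin k → ℝ × ℝ) (y : ℝ)
    (u : Fin k → Node) : ℕ :=
  ∑ s ∈ coveringSums D h m C ω y u, (pointsIn (topSet P u y m) (ext h s u)).card

/-- The law of the points `(x_i, z_i)`: independent and uniform in the unit square. -/
def diagramLaw (k : ℕ) : Measure (Fin k → ℝ × ℝ) :=
  Measure.pi (fun _ => volume.restrict (Set.Icc (0 : ℝ) 1 ×ˢ Set.Icc (0 : ℝ) 1))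

/-- The law of `y`: uniform in `[0, 1]`. -/
def yLaw : Measure ℝ := volume.restrict (Set.Icc 0 1)

/-- The law of the random query. -/
def queryLaw (k : ℕ) : Measure ((Fin k → ℝ × ℝ) × ℝ) := (diagramLaw k).prod yLaw

/-- The event that the `j`-subproblem and its `m`-top are well-defined. -/
def wellDefined (P : Finset (Pt k)) (h m : ℕ) (j : Fin k → ℕ) : Set ((Fin k → ℝ × ℝ) × ℝ) :=
  {q | ∃ u, IsDefining h j q.1 u ∧ TopDefined P u q.2 m}

/-- The expected total coverage over the random choice of `y`, given the points `(x_i, z_i)`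
and given that the `j`-subproblem and the `m`-top are well-defined. -/
def expectedCoverage {P : Finset (Pt k)} (D : SumFamily P) (h m C : ℕ) (j : Fin k → ℕ)
    (ω : Fin k → ℝ × ℝ) (u : Fin k → Node) : ℝ≥0∞ :=
  ∫⁻ y, (coverage D h m C ω y u : ℝ≥0∞) ∂(cond yLaw {y | (ω, y) ∈ wellDefined P h m j})

end Query

/-- `λ = δ h^k / (j_1 ⋯ j_k) · n / S⁺`. -/
def lam {k : ℕ} {P : Finset (Pt k)} (δ : ℝ) (D : SumFamily P) (j : Fin k → ℕ) : ℝ :=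
  δ * (height P.card : ℝ) ^ k / (∏ i, (j i : ℝ)) * ((P.card : ℝ) / D.storage)

/-- The number `⌈λ⌉` of points in the `λ`-top. -/
def topSize {k : ℕ} {P : Finset (Pt k)} (δ : ℝ) (D : SumFamily P) (j : Fin k → ℕ) : ℕ :=
  ⌈lam δ D j⌉₊

end RangeLB

end

/-! Claim 2 is a first-moment estimate over the random defining nodes `u`, of depths d_i, and the
random y. Write m = ⌈λ⌉ and k = d - 1. Fix `u`. The lower density bound gives the top a height of at
most H = O(m/(εn) ∏ 2^{d_i}). Let s be a sum in the covering family, placed at depths a_i. It is not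
a singleton, since those cover at most ⌈1/ε⌉ < C points. What it covers lies in a box with sides
2^{-max(a_i,d_i)} and H, hence is at most (n/ε) H ∏ 2^{-max(a_i,d_i)} points. Moreover y lies in a
window of length H above the top of s (`WellDistributed.card_ext_le`). So s contributes at most this
bound times H to the integral over y.

The tuple `u` is defining with probability at most ∏ 2^{-d_i}/h, and the weighted sum over `u`
factors over the axes. On each axis u_i is determined by its depth, being the left child of the node
that contains the right end of s, and d_i ≤ a_i + j_i (`IsDefining.linked`). The factor of the axis
is therefore O(1/h) ∑_{d ≤ a_i+j_i} 2^{d-max(a_i,d)} = O(j_i/h): a geometric series up to a_i, then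
j_i terms equal to 1. Over all S⁺ sums this gives O(S⁺ m² ∏ j_i / (ε³ n h^k)) = O(δ m²/(ε³λ)), which
is O(δm/ε³) once m ≥ 2.

By Markov's inequality (`WellDistributed.queryLaw_bad_le`) the bad well-defined queries have measure
at most Aδ, with A depending on k, ε, C' only. Conditioning divides this by at least c, and δ₀ is
chosen so that Aδ/c ≤ √(δ/ε); thus K = 1 suffices.

Claim 1 holds because with probability bounded below all v_i are shallow, each x_i lies in a right
child at the required depth, and y ≥ 1/2. Then r(u) is large enough for the lower density bound to
supply m points. -/

namespace RangeLB

/-! ### Dyadic cells -/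

namespace Node

/-- The right boundary of the box `r(v)` along `X_i`. -/
noncomputable def right (v : Node) : ℝ := (v.idx + 1) / 2 ^ v.depth

theorem cell_eq (v : Node) : v.cell = Set.Ico v.left v.right := rfl

theorem right_sub_left (v : Node) : v.right - v.left = (2 ^ v.depth)⁻¹ := by
  rw [right, left]; field_simp; ring

theorem left_lt_right (v : Node) : v.left < v.right := by
  have : (0 : ℝ) < (2 ^ v.depth)⁻¹ := by positivity
  linarith [v.right_sub_left]

theorem left_nonneg (v : Node) : 0 ≤ v.left := by
  rw [left]; positivity

theorem right_le_one {h : ℕ} {v : Node} (hv : v.InTree h) : v.right ≤ 1 := by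
  rw [right, div_le_one (by positivity)]
  exact_mod_cast hv.2

theorem mid_sub_left (v : Node) : v.mid - v.left = (2 ^ (v.depth + 1))⁻¹ := by
  rw [mid, left]; field_simp; ring

theorem left_lt_mid (v : Node) : v.left < v.mid := by
  have : (0 : ℝ) < (2 ^ (v.depth + 1))⁻¹ := by positivity
  linarith [v.mid_sub_left]

theorem mid_lt_right (v : Node) : v.mid < v.right := by
  rw [mid, right, div_lt_div_iff₀ (by positivity) (by positivity), pow_succ]
  have : (0 : ℝ) < 2 ^ v.depth := by positivity
  nlinarith

theorem mem_cell_iff {v : Node} {x : ℝ} :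
    x ∈ v.cell ↔ (v.idx : ℝ) ≤ x * 2 ^ v.depth ∧ x * 2 ^ v.depth < v.idx + 1 := by
  rw [cell, left, Set.mem_Ico, div_le_iff₀ (by positivity), lt_div_iff₀ (by positivity)]

theorem nonneg_of_mem_cell {v : Node} {x : ℝ} (hx : x ∈ v.cell) : 0 ≤ x :=
  v.left_nonneg.trans hx.1

theorem lt_one_of_mem_cell {h : ℕ} {v : Node} (hv : v.InTree h) {x : ℝ} (hx : x ∈ v.cell) :
    x < 1 :=
  lt_of_lt_of_le hx.2 (right_le_one hv)

theorem mem_cell_iff_floor {v : Node} {x : ℝ} (hx : 0 ≤ x) :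
    x ∈ v.cell ↔ ⌊x * 2 ^ v.depth⌋₊ = v.idx := by
  rw [mem_cell_iff, Nat.floor_eq_iff (by positivity)]

theorem mem_cell_nodeAt (h : ℕ) {x : ℝ} (hx : 0 ≤ x) (z : ℝ) : x ∈ (nodeAt h x z).cell :=
  (mem_cell_iff_floor hx).2 rfl

theorem eq_of_mem_cell {v w : Node} (hd : v.depth = w.depth) {x : ℝ} (hv : x ∈ v.cell)
    (hw : x ∈ w.cell) : v = w := by
  have h0 := nonneg_of_mem_cell hv
  rw [mem_cell_iff_floor h0] at hv hw
  rw [Node.ext_iff]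
  exact ⟨hd, by rw [← hv, ← hw, hd]⟩

/-- Dyadic intervals that meet are nested; at the finer scale this is a comparison of integer
indices. -/
theorem cell_subset_of_mem {v w : Node} (hd : v.depth ≤ w.depth) {x : ℝ} (hv : x ∈ v.cell)
    (hw : x ∈ w.cell) : w.cell ⊆ v.cell := by
  obtain ⟨e, he⟩ := Nat.exists_eq_add_of_le hd
  have h2 : (0 : ℝ) < 2 ^ e := by positivity
  rw [mem_cell_iff] at hv hw
  rw [he, pow_add, ← mul_assoc] at hw
  have h1 : v.idx * 2 ^ e < w.idx + 1 := by
    have : (v.idx : ℝ) * 2 ^ e < w.idx + 1 :=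
      lt_of_le_of_lt (mul_le_mul_of_nonneg_right hv.1 h2.le) hw.2
    exact_mod_cast this
  have h3 : w.idx < (v.idx + 1) * 2 ^ e := by
    have : (w.idx : ℝ) < (v.idx + 1) * 2 ^ e :=
      lt_of_le_of_lt hw.1 (mul_lt_mul_of_pos_right hv.2 h2)
    exact_mod_cast this
  have h1' : (v.idx : ℝ) * 2 ^ e ≤ w.idx := by exact_mod_cast Nat.lt_succ_iff.1 h1
  have h3' : (w.idx : ℝ) + 1 ≤ (v.idx + 1) * 2 ^ e := by exact_mod_cast h3
  intro t ht
  rw [mem_cell_iff] at ht ⊢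
  rw [he, pow_add, ← mul_assoc] at ht
  exact ⟨le_of_mul_le_mul_right (h1'.trans ht.1) h2,
    lt_of_mul_lt_mul_right (lt_of_lt_of_le ht.2 h3') h2.le⟩

/-- An inner boundary of depth `d` is the cutting hyperplane of a node of smaller depth. -/
theorem exists_mid_eq (d : ℕ) : ∀ c : ℕ, 0 < c → c < 2 ^ d →
    ∃ v : Node, v.depth < d ∧ v.idx < 2 ^ v.depth ∧ v.mid = (c : ℝ) / 2 ^ d := by
  induction d with
  | zero => intro c h0 h1; simp at h1; omega
  | succ d ih =>
    intro c h0 h1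
    rw [pow_succ] at h1
    rcases Nat.even_or_odd' c with ⟨b, rfl | rfl⟩
    · obtain ⟨v, hv, hi, hm⟩ := ih b (by omega) (by omega)
      refine ⟨v, by omega, hi, ?_⟩
      rw [hm, pow_succ]; push_cast; field_simp
    · refine ⟨⟨d, b⟩, by simp, by simp; omega, ?_⟩
      simp [mid]

end Node

/-! ### Where a sum is placed -/

section Placement

variable {k h : ℕ} {s : Finset (Pt k)} {i : Fin k}

theorem mem_xRange_of_mem {p : Pt k} (hp : p ∈ s) : p.1 i ∈ xRange s i :=
  ⟨p, hp, p, hp, le_rfl, le_rfl⟩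

/-- An end of r(w) interior to [0,1] is the cutting hyperplane of a shallower node. A point of s
beyond it would make s cross that node, against the minimal depth of w. -/
theorem PlacedAt.mem_cell {w : Node} (hw : PlacedAt h s i w)
    (hs : ∀ p ∈ s, 0 ≤ p.1 i ∧ p.1 i < 1) {p : Pt k} (hp : p ∈ s) : p.1 i ∈ w.cell := by
  rcases hw with ⟨⟨⟨hd, hi⟩, -, a, ha, b, hb, ham, hbm⟩, hmin⟩ | ⟨-, -, -, hsub⟩
  · constructor
    · by_contra! hlt
      rcases Nat.eq_zero_or_pos w.idx with h0 | h0
      · rw [Node.left, h0] at hlt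
        simp at hlt
        linarith [(hs p hp).1]
      · obtain ⟨v, hv, hvi, hm⟩ := Node.exists_mid_eq w.depth w.idx h0 hi
        have := hmin v ⟨⟨by omega, hvi⟩, by omega, p, hp, b, hb, by rw [hm]; exact hlt, by
          rw [hm]; exact (w.left_lt_mid.le).trans hbm⟩
        omega
    · by_contra! hle
      rcases (Nat.succ_le_of_lt hi).eq_or_lt with h0 | h0
      · have : w.right = 1 := by
          rw [Node.right, div_eq_one_iff_eq (by positivity)]
          exact_mod_cast h0
        have h1 : w.right ≤ p.1 i := hle
        linarith [(hs p hp).2]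
      · obtain ⟨v, hv, hvi, hm⟩ := Node.exists_mid_eq w.depth (w.idx + 1) (by omega) h0
        have e : v.mid = w.right := by rw [hm, Node.right]; push_cast; rfl
        have := hmin v ⟨⟨by omega, hvi⟩, by omega, a, ha, p, hp, by
          rw [e]; exact ham.trans w.mid_lt_right, by rw [e]; exact hle⟩
        omega
  · exact hsub (mem_xRange_of_mem hp)

theorem PlacedAt.depth_unique {w w' : Node} (hw : PlacedAt h s i w) (hw' : PlacedAt h s i w') :
    w.depth = w'.depth := by
  rcases hw with ⟨hc, hm⟩ | ⟨hn, -, hd, -⟩ <;> rcases hw' with ⟨hc', hm'⟩ | ⟨hn', -, hd', -⟩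
  · exact le_antisymm (hm _ hc') (hm' _ hc)
  · exact absurd hc (hn' _)
  · exact absurd hc' (hn _)
  · omega

theorem PlacedAt.unique {w w' : Node} (hw : PlacedAt h s i w) (hw' : PlacedAt h s i w')
    (hs : ∀ p ∈ s, 0 ≤ p.1 i ∧ p.1 i < 1) (hne : s.Nonempty) : w = w' := by
  obtain ⟨p, hp⟩ := hne
  exact Node.eq_of_mem_cell (hw.depth_unique hw') (hw.mem_cell hs hp) (hw'.mem_cell hs hp)

/-- A sum is placed at or below every node whose box contains it. -/
theorem PlacedAt.depth_le {v w : Node} (hw : PlacedAt h s i w) (hv : v.depth ≤ h)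
    (hs : ∀ p ∈ s, p.1 i ∈ v.cell) : v.depth ≤ w.depth := by
  rcases hw with ⟨⟨-, -, a, ha, b, hb, ham, hbm⟩, -⟩ | ⟨-, -, hd, -⟩
  · by_contra! hlt
    obtain ⟨e, he⟩ := Nat.exists_eq_add_of_le (Nat.succ_le_of_lt hlt)
    have h2 : (0 : ℝ) < 2 ^ v.depth := by positivity
    -- In units of 2^{-depth(v)} the hyperplane of a shallower node is an integer, so it cannot lie
    -- strictly between the ends of r(v).
    have hM : w.mid * 2 ^ v.depth = (((2 * w.idx + 1) * 2 ^ e : ℕ) : ℝ) := by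
      rw [Node.mid, he, Nat.succ_eq_add_one, pow_add _ (w.depth + 1)]
      push_cast; field_simp
    have h3 := (Node.mem_cell_iff.1 (hs a ha)).1
    have h4 := (Node.mem_cell_iff.1 (hs b hb)).2
    have h5 := lt_of_le_of_lt h3 (mul_lt_mul_of_pos_right ham h2)
    have h6 := lt_of_le_of_lt (mul_le_mul_of_nonneg_right hbm h2.le) h4
    rw [hM] at h5 h6
    have h7 : v.idx < (2 * w.idx + 1) * 2 ^ e := by exact_mod_cast h5
    have h8 : (2 * w.idx + 1) * 2 ^ e < v.idx + 1 := by exact_mod_cast h6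
    omega
  · omega

open Classical in
/-- The depth of the node of `T_i` at which `s` is placed. -/
noncomputable def placedDepth (h : ℕ) (s : Finset (Pt k)) (i : Fin k) : ℕ :=
  if H : ∃ w, PlacedAt h s i w then H.choose.depth else 0

theorem PlacedAt.placedDepth_eq {w : Node} (hw : PlacedAt h s i w) :
    placedDepth h s i = w.depth := by
  have H : ∃ w, PlacedAt h s i w := ⟨w, hw⟩
  rw [placedDepth, dif_pos H]
  exact H.choose_spec.depth_unique hw

theorem PlacedAt.depth_of_card_eq_one {w : Node} (hw : PlacedAt h s i w) (hs : s.card = 1) :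
    w.depth = h := by
  rcases hw with ⟨⟨-, -, a, ha, b, hb, ham, hbm⟩, -⟩ | ⟨-, -, hd, -⟩
  · obtain rfl := Finset.card_le_one.1 hs.le a ha b hb
    linarith
  · exact hd

/-- The right end of the `X_i`-range of `s`. -/
noncomputable def maxX (s : Finset (Pt k)) (i : Fin k) : ℝ :=
  sSup ((fun p : Pt k => p.1 i) '' s)

theorem maxX_mem (hs : s.Nonempty) : ∃ p ∈ s, p.1 i = maxX s i := by
  have := (hs.image (fun p : Pt k => p.1 i)).csSup_mem
  rw [Finset.coe_image] at this
  obtain ⟨p, hp, he⟩ := Finset.mem_image.1 this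
  exact ⟨p, hp, he⟩

theorem le_maxX {p : Pt k} (hp : p ∈ s) : p.1 i ≤ maxX s i :=
  le_csSup ((s.finite_toSet.image _).bddAbove) ⟨p, hp, rfl⟩

/-- The top boundary of `b(s)`. -/
noncomputable def maxY (s : Finset (Pt k)) : ℝ := sSup ((fun p : Pt k => p.2) '' s)

theorem maxY_mem (hs : s.Nonempty) : ∃ p ∈ s, p.2 = maxY s := by
  have := (hs.image (fun p : Pt k => p.2)).csSup_mem
  rw [Finset.coe_image] at this
  obtain ⟨p, hp, he⟩ := Finset.mem_image.1 this
  exact ⟨p, hp, he⟩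

theorem le_maxY {p : Pt k} (hp : p ∈ s) : p.2 ≤ maxY s :=
  le_csSup ((s.finite_toSet.image _).bddAbove) ⟨p, hp, rfl⟩

end Placement

/-! ### Defining nodes and the sums usable for them -/

section Defining

variable {k h : ℕ} {j : Fin k → ℕ} {ω : Fin k → ℝ × ℝ} {u : Fin k → Node}

theorem IsDefining.query_nonneg (hu : IsDefining h j ω u) (i : Fin k) : 0 ≤ (ω i).1 :=
  Node.nonneg_of_mem_cell (hu i).2.2.2.2

theorem IsDefining.query_lt_one (hu : IsDefining h j ω u) (i : Fin k) : (ω i).1 < 1 :=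
  Node.lt_one_of_mem_cell (hu i).2.2.2.1 (hu i).2.2.2.2

theorem IsDefining.unique {u' : Fin k → Node} (hu : IsDefining h j ω u)
    (hu' : IsDefining h j ω u') : u = u' := by
  funext i
  have hd : (u i).depth = (u' i).depth := by rw [(hu i).2.1, (hu' i).2.1]
  have := Node.eq_of_mem_cell (by exact hd) (hu i).2.2.2.2 (hu' i).2.2.2.2
  rw [Node.ext_iff] at this ⊢
  exact ⟨hd, Nat.succ_injective this.2⟩

/-- The condition that links a defining node `v` of the `j`-subproblem to a sum with right end `t`
that is placed at depth `a`. -/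
def Linked (a j : ℕ) (t : ℝ) (v : Node) : Prop :=
  1 ≤ v.depth ∧ v.depth ≤ a + j ∧ v.idx = 2 * ⌊t * 2 ^ (v.depth - 1)⌋₊

variable {s : Finset (Pt k)} {y : ℝ}

theorem IsDefining.sum_mem_Ico (hu : IsDefining h j ω u) (hq : ∀ p ∈ s, p ∈ query h ω y)
    {p : Pt k} (hp : p ∈ s) (i : Fin k) : 0 ≤ p.1 i ∧ p.1 i < 1 :=
  ⟨(Node.left_nonneg _).trans ((hq p hp).1 i).1,
    lt_of_le_of_lt ((hq p hp).1 i).2 (hu.query_lt_one i)⟩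

/-- The sum lies in r(v_i), so it is placed no higher than v_i, which bounds the depth of u_i. Its
right end lies between a point of r(u_i) and x_i, which is in the right sibling; hence it lies in
the parent's cell, and u_i is the left child there. -/
theorem IsDefining.linked (hu : IsDefining h j ω u) (hj : ∀ i, 1 ≤ j i)
    (hq : ∀ p ∈ s, p ∈ query h ω y) {r : Pt k} (hr : r ∈ sumBox s) (hru : r ∈ subregion u y)
    {i : Fin k} {w : Node} (hw : PlacedAt h s i w) :
    Linked w.depth (j i) (maxX s i) (u i) := by
  obtain ⟨ht, hd, he, ht', hx⟩ := hu i
  have h1 : 1 ≤ (u i).depth := by have := hj i; omega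
  refine ⟨h1, ?_, ?_⟩
  · have : (Node.nodeAt h (ω i).1 (ω i).2).depth ≤ w.depth := by
      refine hw.depth_le (by have := ht.1; omega) fun p hp => ?_
      exact ⟨((hq p hp).1 i).1, lt_of_le_of_lt ((hq p hp).1 i).2
        (Node.mem_cell_nodeAt h (hu.query_nonneg i) (ω i).2).2⟩
    omega
  · obtain ⟨-, -, b, hb, -, hrb⟩ := hr.1 i
    obtain ⟨p, hp, hpm⟩ := maxX_mem (i := i) ⟨b, hb⟩
    have h2 : (maxX s i) ≤ (ω i).1 := hpm ▸ ((hq p hp).1 i).2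
    have h3 : r.1 i ≤ maxX s i := hrb.trans (le_maxX hb)
    obtain ⟨c, hc⟩ := he
    obtain ⟨e, he⟩ := Nat.exists_eq_add_of_le' h1
    have h4 := (Node.mem_cell_iff.1 (hru.1 i)).1
    have h5 := (Node.mem_cell_iff.1 hx).2
    simp only [hc, he] at h4 h5
    rw [pow_succ] at h4 h5
    have h0 : (0 : ℝ) < 2 ^ e := by positivity
    have h6 : ⌊maxX s i * 2 ^ e⌋₊ = c := by
      have h7 : r.1 i * 2 ^ e ≤ maxX s i * 2 ^ e := mul_le_mul_of_nonneg_right h3 h0.le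
      have h8 : maxX s i * 2 ^ e ≤ (ω i).1 * 2 ^ e := mul_le_mul_of_nonneg_right h2 h0.le
      push_cast at h4 h5
      have h9 : (c : ℝ) ≤ maxX s i * 2 ^ e := by linarith
      rw [Nat.floor_eq_iff ((Nat.cast_nonneg c).trans h9)]
      exact ⟨h9, by linarith⟩
    rw [he, Nat.add_sub_cancel, h6, hc]; ring

/-- Inside `r(u)`, the extension of a sum lies in a dyadic cell whose depth is the larger one of the
depth of `u` and the depth of placement. -/
theorem IsDefining.exists_cell (hu : IsDefining h j ω u) (hq : ∀ p ∈ s, p ∈ query h ω y)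
    {r : Pt k} (hr : r ∈ sumBox s) (hru : r ∈ subregion u y)
    {i : Fin k} {w : Node} (hw : PlacedAt h s i w) :
    ∃ N : Node, N.depth = max w.depth (u i).depth ∧
      ∀ t ∈ extRange h s i (u i), t ∈ (u i).cell → t ∈ N.cell := by
  obtain ⟨a, ha, b, hb, har, hrb⟩ := hr.1 i
  have hs : ∀ p ∈ s, 0 ≤ p.1 i ∧ p.1 i < 1 := fun p hp => hu.sum_mem_Ico hq hp i
  rcases le_or_gt (u i).depth w.depth with hle | hlt
  · have hrw : r.1 i ∈ w.cell :=
      ⟨(hw.mem_cell hs ha).1.trans har, lt_of_le_of_lt hrb (hw.mem_cell hs hb).2⟩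
    have hsub := Node.cell_subset_of_mem hle (hru.1 i) hrw
    refine ⟨w, by omega, fun t ht _ => ?_⟩
    obtain ⟨w', hw', hif⟩ := ht
    obtain rfl := hw.unique hw' hs ⟨a, ha⟩
    rwa [if_pos hsub] at hif
  · exact ⟨u i, by omega, fun t _ h => h⟩

end Defining

/-! ### Height of the top -/

section Counting

variable {k : ℕ} {ε : ℝ} {P : Finset (Pt k)} {u : Fin k → Node} {y : ℝ} {m : ℕ}

theorem pointsIn_mono {P Q : Finset (Pt k)} {R S : Set (Pt k)} (h : ∀ p ∈ P, p ∈ R → p ∈ Q ∧ p ∈ S) :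
    pointsIn P R ⊆ pointsIn Q S := fun p hp => by
  rw [mem_pointsIn] at hp ⊢
  exact h p hp.1 hp.2

/-- An upper bound for the height of the `m`-top. -/
noncomputable def topHeight (ε : ℝ) (n m : ℕ) (u : Fin k → Node) : ℝ :=
  2 * m / (ε * n) * ∏ i, (2 : ℝ) ^ ((u i).depth + 1)

theorem topHeight_pos (hε : 0 < ε) {n : ℕ} (hn : 0 < n) (hm : 0 < m) : 0 < topHeight ε n m u := by
  rw [topHeight]; positivity

/-- The volume of the left half of `r(u)`, in each direction, with height `b - a`. -/
theorem rectVol_left_mid (u : Fin k → Node) (a b : ℝ) :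
    rectVol (fun i => (u i).left, a) (fun i => (u i).mid, b) =
      (∏ i, (2 : ℝ) ^ ((u i).depth + 1))⁻¹ * (b - a) := by
  simp only [rectVol, Node.mid_sub_left, Finset.prod_inv_distrib]

theorem left_mem_unitCube {h : ℕ} (hu : ∀ i, (u i).InTree h) {b : ℝ} (h0 : 0 ≤ b) (h1 : b ≤ 1) :
    ((fun i => (u i).left, b) : Pt k) ∈ unitCube k :=
  ⟨fun i => ⟨(u i).left_nonneg, (u i).left_lt_right.le.trans (Node.right_le_one (hu i))⟩, h0, h1⟩

theorem mid_mem_unitCube {h : ℕ} (hu : ∀ i, (u i).InTree h) {b : ℝ} (h0 : 0 ≤ b) (h1 : b ≤ 1) :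
    ((fun i => (u i).mid, b) : Pt k) ∈ unitCube k :=
  ⟨fun i => ⟨(u i).left_nonneg.trans (u i).left_lt_mid.le,
    (u i).mid_lt_right.le.trans (Node.right_le_one (hu i))⟩, h0, h1⟩

/-- A region over r(u) with only m points cannot be tall, by the lower density bound. That bound
needs a rectangle inside the cube, hence the level `a ≥ 0` in place of `y - β`, which may be
negative. -/
theorem WellDistributed.sub_le_topHeight (hP : WellDistributed ε P) (hε : 0 < ε)
    (hn : 0 < P.card) (hm : 0 < m) {h : ℕ} (hu : ∀ i, (u i).InTree h) (hy : y ≤ 1) {β : ℝ}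
    (hβ : (pointsIn P (topBox u y β)).card = m) {a : ℝ} (h0 : 0 ≤ a) (ha : y - β ≤ a) (hay : a ≤ y) :
    y - a ≤ topHeight ε P.card m u := by
  rcases hay.eq_or_lt with rfl | hlt
  · rw [sub_self]; exact (topHeight_pos hε hn hm).le
  -- The closed rectangle ends at the midpoints so as to stay inside the half-open cells; this costs
  -- a factor 2 per axis.
  have key := hP.le_card (fun i => (u i).left, a) (fun i => (u i).mid, y)
    (fun i => (u i).left_lt_mid) hlt (left_mem_unitCube hu h0 (by linarith))
    (mid_mem_unitCube hu (by linarith) hy)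
  have hsub : pointsIn P (rect (fun i => (u i).left, a) (fun i => (u i).mid, y)) ⊆
      pointsIn P (topBox u y β) := pointsIn_mono fun p hp hr =>
    ⟨hp, fun i => ⟨(hr.1 i).1, lt_of_le_of_lt (hr.1 i).2 (u i).mid_lt_right⟩,
      ha.trans hr.2.1, hr.2.2⟩
  have h1 := (key.trans (Finset.card_le_card hsub)).trans hβ.le
  have h2 := Nat.lt_of_floor_lt (Nat.lt_succ_of_le h1)
  rw [rectVol_left_mid] at h2
  have hm' : ((m.succ : ℕ) : ℝ) ≤ 2 * m := by
    have : (1 : ℝ) ≤ m := by exact_mod_cast hm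
    push_cast; linarith
  have h3 := h2.trans_le hm'
  have hn' : (0 : ℝ) < P.card := by exact_mod_cast hn
  have hp : (0 : ℝ) < ∏ i, (2 : ℝ) ^ ((u i).depth + 1) := by positivity
  rw [topHeight, div_mul_eq_mul_div, le_div_iff₀ (by positivity)]
  have h4 : ε * ((∏ i, (2 : ℝ) ^ ((u i).depth + 1))⁻¹ * (y - a)) * P.card *
      (∏ i, (2 : ℝ) ^ ((u i).depth + 1)) = (y - a) * (ε * P.card) := by field_simp
  rw [← h4]
  exact (mul_lt_mul_of_pos_right h3 hp).le

end Counting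

/-! ### Points of the top covered by one sum -/

section Coverage

variable {k h : ℕ} {ε : ℝ} {P : Finset (Pt k)} {j : Fin k → ℕ} {ω : Fin k → ℝ × ℝ}
  {u : Fin k → Node} {s : Finset (Pt k)} {y : ℝ} {m C : ℕ}

theorem exists_placedAt_of_mem_ext {p : Pt k} (hp : p ∈ ext h s u) (i : Fin k) :
    ∃ w, PlacedAt h s i w := by
  obtain ⟨w, hw, -⟩ := hp.1 i
  exact ⟨w, hw⟩

theorem mem_pointsIn_topSet {β : ℝ} (h0 : 0 ≤ β) (hβ : (pointsIn P (topBox u y β)).card = m)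
    {p : Pt k} : p ∈ pointsIn (topSet P u y m) (ext h s u) ↔
      p ∈ P ∧ p ∈ topBox u y β ∧ p ∈ ext h s u := by
  rw [mem_pointsIn, topSet_eq P u y m β h0 hβ, mem_pointsIn, and_assoc]

/-- The extension of a singleton covers few points of the top. -/
theorem WellDistributed.card_ext_singleton_le (hP : WellDistributed ε P) (hε : 0 < ε) (hk : 1 ≤ k)
    (hu : IsDefining (height P.card) j ω u) (htop : TopDefined P u y m)
    (hq : ∀ p ∈ s, p ∈ query (height P.card) ω y)
    {r : Pt k} (hr : r ∈ sumBox s) (hru : r ∈ subregion u y) (hs : s.card = 1) :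
    (pointsIn (topSet P u y m) (ext (height P.card) s u)).card ≤ ⌈1 / ε⌉₊ := by
  obtain ⟨β, h0, hβ⟩ := htop
  rcases Finset.eq_empty_or_nonempty (pointsIn (topSet P u y m) (ext (height P.card) s u)) with
    he | ⟨p, hp⟩
  · rw [he]; simp
  rw [mem_pointsIn_topSet h0 hβ] at hp
  -- One axis suffices: a singleton is placed at a leaf, whose slab has volume 2^{-h} < 1/n.
  let i : Fin k := ⟨0, hk⟩
  obtain ⟨w, hw⟩ := exists_placedAt_of_mem_ext hp.2.2 i
  obtain ⟨N, hN, hNt⟩ := hu.exists_cell hq hr hru hw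
  rw [hw.depth_of_card_eq_one hs, max_eq_left (hu i).1.1] at hN
  let a : Pt k := (fun i' => if i' = i then N.left else 0, 0)
  let b : Pt k := (fun i' => if i' = i then N.right else 1, 1)
  have hab : ∀ i', a.1 i' < b.1 i' := fun i' => by
    by_cases hi : i' = i
    · simp only [a, b, if_pos hi]; exact N.left_lt_right
    · simp only [a, b, if_neg hi]; exact one_pos
  have hsub : pointsIn (topSet P u y m) (ext (height P.card) s u) ⊆ pointsIn P (rect a b) := by
    intro p hp
    rw [mem_pointsIn_topSet h0 hβ] at hp
    have hc := hP.subset_cube p hp.1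
    refine mem_pointsIn.2 ⟨hp.1, fun i' => ?_, hc.2⟩
    by_cases hi : i' = i
    · subst hi
      simp only [a, b, if_pos]
      have := hNt _ (hp.2.2.1 i) (hp.2.1.1 i)
      exact ⟨this.1, this.2.le⟩
    · simp only [a, b, if_neg hi]; exact hc.1 i'
  refine (Finset.card_le_card hsub).trans ((hP.card_le a b hab one_pos).trans
    (Nat.ceil_mono ?_))
  have hvol : rectVol a b = (2 ^ height P.card)⁻¹ := by
    rw [rectVol, Finset.prod_eq_single i]
    · simp [a, b, Node.right_sub_left, hN]
    · intro i' _ hi; simp [a, b, hi]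
    · simp
  rw [hvol]
  gcongr
  rw [inv_mul_le_one₀ (by positivity)]
  exact_mod_cast (Nat.lt_pow_succ_log_self one_lt_two P.card).le

/-- A bound for the number of points of the top covered by the extension of a sum, together with
the height at which the sum lies. -/
theorem WellDistributed.card_ext_le (hP : WellDistributed ε P) (hε : 0 < ε)
    (hu : IsDefining h j ω u) (htop : TopDefined P u y m) (hy : y ≤ 1) (hm : 0 < m)
    (hq : ∀ p ∈ s, p ∈ query h ω y) {r : Pt k} (hr : r ∈ sumBox s) (hru : r ∈ subregion u y)
    (hcard : 2 ≤ (pointsIn (topSet P u y m) (ext h s u)).card) :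
    y ∈ Set.Icc (maxY s) (maxY s + topHeight ε P.card m u) ∧
      ((pointsIn (topSet P u y m) (ext h s u)).card : ℝ) ≤
        P.card / ε * (topHeight ε P.card m u *
          ∏ i, (2 ^ max (placedDepth h s i) (u i).depth)⁻¹) := by
  obtain ⟨β, h0, hβ⟩ := htop
  have hne : (pointsIn (topSet P u y m) (ext h s u)).Nonempty :=
    Finset.card_pos.1 (by omega)
  -- The lowest covered point is the floor of the bounding box. Being below the top of s and at most
  -- `topHeight` below y, it also confines y to the window.
  obtain ⟨p, hp, hmin⟩ := Finset.exists_min_image _ (fun p : Pt k => p.2) hne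
  rw [mem_pointsIn_topSet h0 hβ] at hp
  have hn : 0 < P.card := Finset.card_pos.2 ⟨p, hp.1⟩
  have hn' : (0 : ℝ) < P.card := by exact_mod_cast hn
  have hW := topHeight_pos (u := u) hε hn hm
  have hwin : y - p.2 ≤ topHeight ε P.card m u :=
    hP.sub_le_topHeight hε hn hm (fun i => (hu i).1) hy hβ (hP.subset_cube p hp.1).2.1
      hp.2.1.2.1 hp.2.1.2.2
  obtain ⟨b, hb, hpb⟩ := hp.2.2.2
  obtain ⟨b', hb', hbm⟩ := maxY_mem (s := s) ⟨b, hb⟩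
  have hpm : p.2 ≤ maxY s := hpb.trans (le_maxY hb)
  have hmy : maxY s ≤ y := hbm ▸ (hq b' hb').2
  refine ⟨⟨hmy, by linarith⟩, ?_⟩
  have hN : ∀ i, ∃ N : Node, N.depth = max (placedDepth h s i) (u i).depth ∧
      ∀ t ∈ extRange h s i (u i), t ∈ (u i).cell → t ∈ N.cell := fun i => by
    obtain ⟨w, hw⟩ := exists_placedAt_of_mem_ext hp.2.2 i
    obtain ⟨N, hN, hNt⟩ := hu.exists_cell hq hr hru hw
    exact ⟨N, by rw [hw.placedDepth_eq]; exact hN, hNt⟩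
  choose N hNd hNt using hN
  have hsub : pointsIn (topSet P u y m) (ext h s u) ⊆
      pointsIn P (rect (fun i => (N i).left, p.2)
        (fun i => (N i).right, p.2 + topHeight ε P.card m u)) := by
    intro p' hp'
    have hle := hmin p' hp'
    rw [mem_pointsIn_topSet h0 hβ] at hp'
    refine mem_pointsIn.2 ⟨hp'.1, fun i => ?_, hle, ?_⟩
    · have := hNt i _ (hp'.2.2.1 i) (hp'.2.1.1 i)
      exact ⟨this.1, this.2.le⟩
    · have := hp'.2.1.2.2
      show p'.2 ≤ p.2 + topHeight ε P.card m u
      linarith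
  have hc := Finset.card_le_card hsub
  have hvol := hP.le_vol (fun i => (N i).left, p.2)
    (fun i => (N i).right, p.2 + topHeight ε P.card m u) (fun i => (N i).left_lt_right)
    (by simpa using hW) (hcard.trans hc)
  have e : rectVol (fun i => (N i).left, p.2)
      (fun i => (N i).right, p.2 + topHeight ε P.card m u) =
      topHeight ε P.card m u * ∏ i, (2 ^ max (placedDepth h s i) (u i).depth : ℝ)⁻¹ := by
    simp only [rectVol, Node.right_sub_left, hNd, add_sub_cancel_left]
    ring
  rw [e, div_le_iff₀ hn'] at hvol
  have hc' : ((pointsIn (topSet P u y m) (ext h s u)).card : ℝ) ≤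
    (pointsIn P (rect (fun i => (N i).left, p.2)
        (fun i => (N i).right, p.2 + topHeight ε P.card m u))).card := by exact_mod_cast hc
  refine hc'.trans ?_
  rw [div_mul_eq_mul_div, le_div_iff₀ hε]
  linarith

end Coverage

/-! ### When the top exists -/

section Top

variable {k : ℕ} {ε : ℝ} {P : Finset (Pt k)} {u : Fin k → Node} {y : ℝ} {m : ℕ}

/-- Two points with the same Y would lie in a slab of volume ε/n, whereas two points need volume
2ε/n. -/
theorem WellDistributed.injOn_snd (hP : WellDistributed ε P) (hε : 0 < ε) :
    Set.InjOn (fun p : Pt k => p.2) P := by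
  intro p hp q hq hpq
  by_contra hne
  have hn : 0 < P.card := Finset.card_pos.2 ⟨p, hp⟩
  have hn' : (0 : ℝ) < P.card := by exact_mod_cast hn
  have hη : 0 < ε / P.card / 3 ^ k := by positivity
  set η := ε / P.card / 3 ^ k with hηd
  have h2 : 2 ≤ (pointsIn P (rect (fun _ => -1, p.2) (fun _ => 2, p.2 + η))).card := by
    have : Finset.card {p, q} ≤ (pointsIn P (rect (fun _ => -1, p.2) (fun _ => 2, p.2 + η))).card := by
      refine Finset.card_le_card fun r hr => ?_
      have hrP : r ∈ P ∧ r.2 = p.2 := by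
        rcases Finset.mem_insert.1 hr with rfl | hr
        · exact ⟨hp, rfl⟩
        · rw [Finset.mem_singleton.1 hr]; exact ⟨hq, hpq.symm⟩
      have hc := hP.subset_cube r hrP.1
      refine mem_pointsIn.2 ⟨hrP.1, fun i => ⟨?_, ?_⟩, hrP.2.ge, ?_⟩
      · have h0 : (0 : ℝ) ≤ r.1 i := (hc.1 i).1
        show (-1 : ℝ) ≤ r.1 i
        linarith
      · have h0 : r.1 i ≤ (1 : ℝ) := (hc.1 i).2
        show r.1 i ≤ (2 : ℝ)
        linarith
      · show r.2 ≤ p.2 + η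
        linarith [hrP.2]
    rwa [Finset.card_pair hne] at this
  have hv := hP.le_vol (fun _ => -1, p.2) (fun _ => 2, p.2 + η) (fun _ => by norm_num)
    (by simpa using hη) h2
  have e : rectVol ((fun _ => -1, p.2) : Pt k) (fun _ => 2, p.2 + η) = ε / P.card := by
    simp only [rectVol, Finset.prod_const, Finset.card_univ, Fintype.card_fin, add_sub_cancel_left]
    rw [hηd]
    norm_num
    field_simp
  rw [e] at hv
  have h2' : (2 : ℝ) ≤ (pointsIn P (rect (fun _ => -1, p.2) (fun _ => 2, p.2 + η))).card := by
    exact_mod_cast h2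
  have := (div_le_div_iff_of_pos_right hn').1 hv
  nlinarith

open Classical in
/-- A finite set on which `f` is injective has upper level sets of every size. -/
theorem exists_card_filter_le_eq {α : Type*} (f : α → ℝ) (S : Finset α) (hf : Set.InjOn f S)
    (m : ℕ) (hm : m ≤ S.card) : ∃ τ, (S.filter (fun p => τ ≤ f p)).card = m := by
  induction m with
  | zero =>
    obtain ⟨M, hM⟩ := (S.finite_toSet.image f).bddAbove
    refine ⟨M + 1, ?_⟩
    rw [Finset.card_eq_zero, Finset.filter_eq_empty_iff]
    intro p hp
    have := hM ⟨p, hp, rfl⟩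
    linarith
  | succ m ih =>
    obtain ⟨τ, hτ⟩ := ih (by omega)
    have hne : (S.filter (fun p => ¬ τ ≤ f p)).Nonempty := by
      rw [← Finset.card_pos]
      have := Finset.card_filter_add_card_filter_not (s := S) (fun p => τ ≤ f p)
      omega
    -- Lowering the threshold to the next largest value adds exactly one element.
    obtain ⟨p, hp, hmax⟩ := Finset.exists_max_image _ f hne
    rw [Finset.mem_filter, not_le] at hp
    refine ⟨f p, ?_⟩
    have : S.filter (fun q => f p ≤ f q) = insert p (S.filter (fun q => τ ≤ f q)) := by
      ext q
      simp only [Finset.mem_filter, Finset.mem_insert]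
      constructor
      · rintro ⟨hq, hpq⟩
        by_cases h : τ ≤ f q
        · exact Or.inr ⟨hq, h⟩
        · exact Or.inl (hf hq hp.1 (le_antisymm (hmax q (Finset.mem_filter.2 ⟨hq, h⟩)) hpq))
      · rintro (rfl | ⟨hq, h⟩)
        · exact ⟨hp.1, le_rfl⟩
        · exact ⟨hq, hp.2.le.trans h⟩
    rw [this, Finset.card_insert_of_notMem, hτ]
    simp [hp.2]

/-- Since the Y-coordinates are distinct, lowering the bottom of the box adds the points one at a
time. Positivity of m makes the resulting β non-negative. -/
theorem topDefined_iff (hP : WellDistributed ε P) (hε : 0 < ε) (hm : 0 < m) :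
    TopDefined P u y m ↔ m ≤ (pointsIn P (subregion u y)).card := by
  classical
  constructor
  · rintro ⟨β, -, rfl⟩
    exact Finset.card_le_card (pointsIn_mono fun p hp h => ⟨hp, h.1, h.2.2⟩)
  · intro hle
    obtain ⟨τ, hτ⟩ := exists_card_filter_le_eq (fun p : Pt k => p.2) (pointsIn P (subregion u y))
      ((hP.injOn_snd hε).mono fun p hp => (mem_pointsIn.1 hp).1) m hle
    refine ⟨y - τ, ?_, ?_⟩
    · rw [← hτ, Finset.card_pos] at hm
      obtain ⟨p, hp⟩ := hm
      rw [Finset.mem_filter, mem_pointsIn] at hp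
      have h1 := hp.1.2.2
      have h2 := hp.2
      linarith
    · rw [← hτ]
      congr 1
      ext p
      simp only [mem_pointsIn, Finset.mem_filter, topBox, subregion, Set.mem_ofPred_eq,
        sub_sub_cancel]
      tauto

theorem measurableSet_topDefined (hP : WellDistributed ε P) (hε : 0 < ε) (hm : 0 < m) :
    MeasurableSet {y | TopDefined P u y m} := by
  refine (IsUpperSet.ordConnected fun a b hab ha => ?_).measurableSet
  rw [Set.mem_ofPred_eq, topDefined_iff hP hε hm] at ha ⊢
  exact ha.trans (Finset.card_le_card (pointsIn_mono fun p hp h => ⟨hp, h.1, h.2.trans hab⟩))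

end Top

/-! ### Integrating the coverage over y -/

section CoverageIntegral

variable {k h : ℕ} {ε : ℝ} {P : Finset (Pt k)} {j : Fin k → ℕ} {ω : Fin k → ℝ × ℝ}
  {u : Fin k → Node} {m C : ℕ}

open Classical in
/-- A bound for the number of points of the top covered by the extension of `s`. -/
noncomputable def coverBound (ε : ℝ) (h n m : ℕ) (j : Fin k → ℕ) (u : Fin k → Node)
    (s : Finset (Pt k)) : ℝ :=
  if ∀ i, Linked (placedDepth h s i) (j i) (maxX s i) (u i) then
    n / ε * (topHeight ε n m u * ∏ i, (2 ^ max (placedDepth h s i) (u i).depth)⁻¹) else 0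

theorem coverBound_nonneg (hε : 0 < ε) (n : ℕ) (s : Finset (Pt k)) :
    0 ≤ coverBound ε h n m j u s := by
  rw [coverBound]
  split_ifs
  · rw [topHeight]; positivity
  · exact le_rfl

/-- The bound depends on y only through the indicators of windows, so integration turns each into a
factor `topHeight`. Singletons drop out because C exceeds what they can cover. -/
theorem WellDistributed.coverage_le (hP : WellDistributed ε P) (hε : 0 < ε) (hk : 1 ≤ k)
    (D : SumFamily P) (hj : ∀ i, 1 ≤ j i) (hC : 2 ≤ C) (hCε : ⌈1 / ε⌉₊ < C) (hm : 0 < m)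
    (hu : IsDefining (height P.card) j ω u) {y : ℝ} (hy : y ≤ 1) (htop : TopDefined P u y m) :
    (coverage D (height P.card) m C ω y u : ℝ≥0∞) ≤
      ∑ s ∈ D.sums.filter (fun s => s.card ≠ 1),
        (Set.Icc (maxY s) (maxY s + topHeight ε P.card m u)).indicator
          (fun _ => ENNReal.ofReal (coverBound ε (height P.card) P.card m j u s)) y := by
  classical
  rw [coverage, Nat.cast_sum]
  have hsub : coveringSums D (height P.card) m C ω y u ⊆ D.sums.filter (fun s => s.card ≠ 1) := by
    intro s hs
    rw [coveringSums, Finset.mem_filter] at hs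
    obtain ⟨hsD, hq, ⟨r, -, hr, hru⟩, hcard⟩ := hs
    refine Finset.mem_filter.2 ⟨hsD, fun h1 => ?_⟩
    have := hP.card_ext_singleton_le hε hk hu htop hq hr hru h1
    omega
  refine (Finset.sum_le_sum fun s hs => ?_).trans (Finset.sum_le_sum_of_subset hsub)
  rw [coveringSums, Finset.mem_filter] at hs
  obtain ⟨hsD, hq, ⟨r, -, hr, hru⟩, hcard⟩ := hs
  obtain ⟨hw, hb⟩ := hP.card_ext_le hε hu htop hy hm hq hr hru (hC.trans hcard)
  rw [Set.indicator_of_mem hw, ← ENNReal.ofReal_natCast]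
  refine ENNReal.ofReal_le_ofReal ?_
  obtain ⟨p, hp⟩ : (pointsIn (topSet P u y m) (ext (height P.card) s u)).Nonempty :=
    Finset.card_pos.1 (by omega)
  rw [coverBound, if_pos fun i => ?_]
  · exact hb
  · obtain ⟨w, hw⟩ := exists_placedAt_of_mem_ext (mem_pointsIn.1 hp).2 i
    rw [hw.placedDepth_eq]
    exact hu.linked hj hq hr hru hw

theorem WellDistributed.setLIntegral_coverage_le (hP : WellDistributed ε P) (hε : 0 < ε)
    (hk : 1 ≤ k) (D : SumFamily P) (hj : ∀ i, 1 ≤ j i) (hC : 2 ≤ C) (hCε : ⌈1 / ε⌉₊ < C)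
    (hm : 0 < m) (hn : 0 < P.card) (hu : IsDefining (height P.card) j ω u) :
    ∫⁻ y in {y | TopDefined P u y m}, (coverage D (height P.card) m C ω y u : ℝ≥0∞) ∂yLaw ≤
      ENNReal.ofReal (∑ s ∈ D.sums.filter (fun s => s.card ≠ 1),
        coverBound ε (height P.card) P.card m j u s * topHeight ε P.card m u) := by
  have hT := measurableSet_topDefined (u := u) hP hε hm
  have hW := topHeight_pos (u := u) hε hn hm
  rw [yLaw, Measure.restrict_restrict hT]
  refine (setLIntegral_mono' (hT.inter measurableSet_Icc) fun y hy =>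
    hP.coverage_le hε hk D hj hC hCε hm hu hy.2.2 hy.1).trans ?_
  refine (setLIntegral_le_lintegral _ _).trans ?_
  rw [lintegral_finsetSum _ fun s _ => measurable_const.indicator measurableSet_Icc,
    ENNReal.ofReal_sum_of_nonneg fun s _ => mul_nonneg (coverBound_nonneg hε _ s) hW.le]
  refine Finset.sum_le_sum fun s _ => ?_
  rw [lintegral_indicator_const measurableSet_Icc, Real.volume_Icc,
    ENNReal.ofReal_mul (coverBound_nonneg hε _ s), add_sub_cancel_left]

end CoverageIntegral

/-! ### Summing over the defining nodes -/

section SumOverNodes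

/-- The nodes of a tree of height `h`. -/
def nodes (h : ℕ) : Finset Node :=
  -- All indices below 2^h are allowed at every depth; the surplus is harmless, as only upper bounds
  -- are summed.
  (Finset.range (h + 1) ×ˢ Finset.range (2 ^ h)).map
    ⟨fun x => ⟨x.1, x.2⟩, fun x y hxy => by
      simp only [Node.mk.injEq] at hxy
      exact Prod.ext hxy.1 hxy.2⟩

theorem mem_nodes {h : ℕ} {v : Node} (hv : v.InTree h) : v ∈ nodes h := by
  refine Finset.mem_map.2 ⟨(v.depth, v.idx), Finset.mem_product.2 ⟨?_, ?_⟩, rfl⟩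
  · simpa using Nat.lt_succ_of_le hv.1
  · simpa using hv.2.trans_le (Nat.pow_le_pow_right two_pos hv.1)

/-- The depths up to a form a geometric series of sum at most 2; each of the j further depths
contributes exactly 1. -/
theorem sum_pow_div_pow_max_le (a j : ℕ) :
    ∑ d ∈ Finset.range (a + j + 1), (2 : ℝ) ^ d * (2 ^ max a d)⁻¹ ≤ j + 2 := by
  induction j with
  | zero =>
    have : ∑ d ∈ Finset.range (a + 0 + 1), (2 : ℝ) ^ d * (2 ^ max a d)⁻¹ =
        (∑ d ∈ Finset.range (a + 1), (2 : ℝ) ^ d) * (2 ^ a)⁻¹ := by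
      rw [Finset.sum_mul]
      refine Finset.sum_congr rfl fun d hd => ?_
      rw [max_eq_left (Nat.lt_succ_iff.1 (Finset.mem_range.1 hd))]
    rw [this, geom_sum_eq (by norm_num), ← div_eq_mul_inv, div_le_iff₀ (by positivity), pow_succ]
    norm_num
    linarith [show (0 : ℝ) < 2 ^ a by positivity]
  | succ j ih =>
    rw [← add_assoc, Finset.sum_range_succ, max_eq_right (by omega), mul_inv_cancel₀ (by positivity)]
    push_cast
    linarith

-- At each depth at most one node is linked to the given right end, so the sum over nodes is at most
-- a sum over depths.
open Classical in
theorem sum_nodes_linked_le (h a j : ℕ) (t : ℝ) :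
    ∑ v ∈ nodes h, (if Linked a j t v then (2 : ℝ) ^ v.depth * (2 ^ max a v.depth)⁻¹ else 0) ≤
      j + 2 := by
  rw [nodes, Finset.sum_map, Finset.sum_product]
  refine le_trans ?_ (sum_pow_div_pow_max_le a j)
  have h1 : ∀ d ∈ Finset.range (h + 1), (∑ c ∈ Finset.range (2 ^ h),
      (if Linked a j t ⟨d, c⟩ then (2 : ℝ) ^ d * (2 ^ max a d)⁻¹ else 0)) ≤
      if d < a + j + 1 then (2 : ℝ) ^ d * (2 ^ max a d)⁻¹ else 0 := by
    intro d _
    split_ifs with hd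
    · refine (Finset.sum_le_sum (g := fun c =>
        if c = 2 * ⌊t * 2 ^ (d - 1)⌋₊ then (2 : ℝ) ^ d * (2 ^ max a d)⁻¹ else 0) fun c _ => ?_).trans ?_
      · by_cases hL : Linked a j t ⟨d, c⟩
        · rw [if_pos hL, if_pos hL.2.2]
        · rw [if_neg hL]; positivity
      · rw [Finset.sum_ite_eq']
        split_ifs
        · exact le_rfl
        · positivity
    · refine (Finset.sum_eq_zero fun c _ => if_neg fun hL => hd ?_).le
      have := hL.2.1
      dsimp only at this
      omega
  refine (Finset.sum_le_sum h1).trans ?_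
  rw [← Finset.sum_filter]
  exact Finset.sum_le_sum_of_subset_of_nonneg (fun d hd => by
    simpa using (Finset.mem_filter.1 hd).2) fun _ _ _ => by positivity

variable {k : ℕ} {ε : ℝ}

/-- The total bound for the coverage, when the defining nodes are weighted by (an upper bound for)
their probability. -/
theorem sum_coverBound_le (hε : 0 < ε) {h n m : ℕ} (hn : 0 < n) {j : Fin k → ℕ}
    (hj : ∀ i, 1 ≤ j i) (s : Finset (Pt k)) :
    ∑ u ∈ Fintype.piFinset (fun _ : Fin k => nodes h),
      (∏ i, ((2 : ℝ) ^ (u i).depth)⁻¹ / h) * (coverBound ε h n m j u s * topHeight ε n m u) ≤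
      4 * 12 ^ k * m ^ 2 * (∏ i, (j i : ℝ)) / (ε ^ 3 * n * h ^ k) := by
  classical
  have hn' : (0 : ℝ) < n := by exact_mod_cast hn
  -- Each axis collects 2^{-d}/h from the probability, 4^{d+1} from the two factors `topHeight`, and
  -- 2^{-max(a,d)} from the box: in total (4/h) 2^{d-max(a,d)}.
  have h1 : ∀ u : Fin k → Node,
      (∏ i, ((2 : ℝ) ^ (u i).depth)⁻¹ / h) * (coverBound ε h n m j u s * topHeight ε n m u) =
      4 * m ^ 2 / (ε ^ 3 * n) * ∏ i, (4 / (h : ℝ) *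
        (if Linked (placedDepth h s i) (j i) (maxX s i) (u i) then
          (2 : ℝ) ^ (u i).depth * (2 ^ max (placedDepth h s i) (u i).depth)⁻¹ else 0)) := by
    intro u
    rw [coverBound]
    split_ifs with hL
    · have e : ∀ i, (4 / (h : ℝ) * (if Linked (placedDepth h s i) (j i) (maxX s i) (u i) then
          (2 : ℝ) ^ (u i).depth * (2 ^ max (placedDepth h s i) (u i).depth)⁻¹ else 0)) =
          (((2 : ℝ) ^ (u i).depth)⁻¹ / h) * 2 ^ ((u i).depth + 1) * 2 ^ ((u i).depth + 1) *
            (2 ^ max (placedDepth h s i) (u i).depth)⁻¹ := fun i => by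
        rw [if_pos (hL i), pow_succ]; field_simp; ring
      rw [Finset.prod_congr rfl fun i _ => e i]
      simp only [Finset.prod_mul_distrib, topHeight]
      field_simp
      ring_nf
    · push Not at hL
      obtain ⟨i, hi⟩ := hL
      rw [zero_mul, mul_zero, eq_comm]
      refine mul_eq_zero_of_right _ (Finset.prod_eq_zero (Finset.mem_univ i) ?_)
      rw [if_neg hi, mul_zero]
  rw [Finset.sum_congr rfl fun u _ => h1 u, ← Finset.mul_sum,
    ← Finset.prod_univ_sum (fun _ => nodes h) (fun i v => 4 / (h : ℝ) *
        (if Linked (placedDepth h s i) (j i) (maxX s i) v then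
          (2 : ℝ) ^ v.depth * (2 ^ max (placedDepth h s i) v.depth)⁻¹ else 0))]
  have h2 : ∏ i, (∑ v ∈ nodes h, (4 / (h : ℝ) *
        (if Linked (placedDepth h s i) (j i) (maxX s i) v then
          (2 : ℝ) ^ v.depth * (2 ^ max (placedDepth h s i) v.depth)⁻¹ else 0))) ≤
      ∏ i, (12 * (j i : ℝ) / h) := by
    refine Finset.prod_le_prod (fun i _ => Finset.sum_nonneg fun v _ => ?_) fun i _ => ?_
    · split_ifs <;> positivity
    · rw [← Finset.mul_sum]
      have h3 := sum_nodes_linked_le h (placedDepth h s i) (j i) (maxX s i)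
      have h4 : (1 : ℝ) ≤ j i := by exact_mod_cast hj i
      -- Since j ≥ 1, j + 2 ≤ 3j; with the factor 4/h this is the 12 j/h.
      refine (mul_le_mul_of_nonneg_left (h3.trans (show _ ≤ 3 * (j i : ℝ) by linarith))
        (by positivity)).trans (le_of_eq ?_)
      ring
  refine (mul_le_mul_of_nonneg_left h2 (by positivity)).trans (le_of_eq ?_)
  rw [Finset.prod_div_distrib, Finset.prod_mul_distrib]
  simp only [Finset.prod_const, Finset.card_univ, Fintype.card_fin]
  field_simp

end SumOverNodes

/-! ### Probability of given defining nodes -/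

section Law

variable {k h : ℕ} {j : Fin k → ℕ}

instance isProbabilityMeasure_uniformSquare :
    IsProbabilityMeasure ((volume : Measure (ℝ × ℝ)).restrict
      (Set.Icc (0 : ℝ) 1 ×ˢ Set.Icc (0 : ℝ) 1)) :=
  ⟨by rw [Measure.restrict_apply_univ, Measure.volume_eq_prod, Measure.prod_prod]; simp⟩

instance isProbabilityMeasure_diagramLaw : IsProbabilityMeasure (diagramLaw k) := by
  unfold diagramLaw; infer_instance

instance isProbabilityMeasure_yLaw : IsProbabilityMeasure yLaw :=
  ⟨by rw [yLaw, Measure.restrict_apply_univ]; simp⟩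

theorem volume_depth_eq_le (hh : 0 < h) (l : ℕ) :
    volume ({z : ℝ | ⌊(1 - z) * h⌋₊ = l} ∩ Set.Icc 0 1) ≤ ENNReal.ofReal ((h : ℝ)⁻¹) := by
  have hR : (0 : ℝ) < h := by exact_mod_cast hh
  have hsub : {z : ℝ | ⌊(1 - z) * h⌋₊ = l} ∩ Set.Icc 0 1 ⊆
      Set.Icc (1 - (l + 1 : ℝ) / h) (1 - (l : ℝ) / h) := by
    rintro z ⟨hz, h0, h1⟩
    rw [Set.mem_ofPred_eq, Nat.floor_eq_iff (mul_nonneg (by linarith) hR.le)] at hz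
    constructor
    · rw [sub_le_comm, le_div_iff₀ hR]; exact hz.2.le
    · rw [le_sub_comm, div_le_iff₀ hR]; exact hz.1
  refine (measure_mono hsub).trans ?_
  rw [Real.volume_Icc]
  refine ENNReal.ofReal_le_ofReal (le_of_eq ?_)
  field_simp
  ring

/-- On each axis x_i must lie in the sibling's cell, of length 2^{-d}, and z_i in one strip of
height 1/h. -/
theorem diagramLaw_isDefining_le (hh : 0 < h) (u : Fin k → Node) :
    diagramLaw k {ω | IsDefining h j ω u} ≤
      ENNReal.ofReal (∏ i, ((2 : ℝ) ^ (u i).depth)⁻¹ / h) := by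
  have hsub : {ω | IsDefining h j ω u} ⊆ Set.pi Set.univ (fun i =>
      (Node.mk (u i).depth ((u i).idx + 1)).cell ×ˢ
        {z : ℝ | ⌊(1 - z) * h⌋₊ = (u i).depth - j i}) := by
    intro ω hω i _
    obtain ⟨-, hd, -, -, hx⟩ := hω i
    refine ⟨hx, ?_⟩
    show ⌊(1 - (ω i).2) * h⌋₊ = (u i).depth - j i
    have : (u i).depth = ⌊(1 - (ω i).2) * h⌋₊ + j i := hd
    omega
  refine (measure_mono hsub).trans ?_
  rw [diagramLaw, Measure.pi_pi, ENNReal.ofReal_prod_of_nonneg fun i _ => by positivity]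
  refine Finset.prod_le_prod' fun i _ => ?_
  rw [Measure.restrict_apply' (measurableSet_Icc.prod measurableSet_Icc), Set.prod_inter_prod,
    Measure.volume_eq_prod, Measure.prod_prod, div_eq_mul_inv, ENNReal.ofReal_mul (by positivity)]
  refine mul_le_mul' ((measure_mono Set.inter_subset_left).trans ?_) (volume_depth_eq_le hh _)
  rw [Node.cell_eq, Real.volume_Ico, Node.right_sub_left]

end Law

/-! ### Markov's inequality -/

section Markov

variable {k h : ℕ} {ε : ℝ} {P : Finset (Pt k)} {j : Fin k → ℕ} {ω : Fin k → ℝ × ℝ}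
  {u : Fin k → Node} {m C : ℕ}

theorem IsDefining.setOf_wellDefined (hu : IsDefining h j ω u) :
    {y | (ω, y) ∈ wellDefined P h m j} = {y | TopDefined P u y m} := by
  ext y
  constructor
  · rintro ⟨u', hu', ht⟩
    rw [hu.unique hu']; exact ht
  · exact fun ht => ⟨u, hu, ht⟩

theorem wellDefined_eq_iUnion : wellDefined P h m j =
    ⋃ u ∈ Fintype.piFinset (fun _ : Fin k => nodes h),
      {ω | IsDefining h j ω u} ×ˢ {y | TopDefined P u y m} := by
  ext ⟨ω, y⟩
  simp only [Set.mem_iUnion, Set.mem_prod, exists_prop]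
  constructor
  · rintro ⟨u, hu, ht⟩
    exact ⟨u, Fintype.mem_piFinset.2 fun i => mem_nodes (hu i).1, hu, ht⟩
  · rintro ⟨u, -, hu, ht⟩
    exact ⟨u, hu, ht⟩

theorem measurable_nodeAt_depth (h : ℕ) : Measurable fun z : ℝ => ⌊(1 - z) * h⌋₊ :=
  Nat.measurable_floor.comp ((measurable_const.sub measurable_id).mul_const _)

theorem measurableSet_isDefining (u : Fin k → Node) :
    MeasurableSet {ω : Fin k → ℝ × ℝ | IsDefining h j ω u} := by
  have : {ω : Fin k → ℝ × ℝ | IsDefining h j ω u} = ⋂ i,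
      {ω : Fin k → ℝ × ℝ | (u i).InTree h ∧ (u i).depth = ⌊(1 - (ω i).2) * h⌋₊ + j i ∧
        Even (u i).idx ∧ (Node.mk (u i).depth ((u i).idx + 1)).InTree h ∧
        (ω i).1 ∈ (Node.mk (u i).depth ((u i).idx + 1)).cell} := by
    ext ω
    simp only [Set.mem_iInter]
    rfl
  rw [this]
  refine MeasurableSet.iInter fun i => ?_
  refine (MeasurableSet.const _).inter (MeasurableSet.inter ?_ ((MeasurableSet.const _).inter
    ((MeasurableSet.const _).inter ?_)))
  · exact measurableSet_eq_fun measurable_const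
      (((measurable_nodeAt_depth h).comp (measurable_pi_apply i).snd).add_const _)
  · exact (measurable_pi_apply i).fst measurableSet_Ico

theorem measurableSet_wellDefined (hP : WellDistributed ε P) (hε : 0 < ε) (hm : 0 < m) :
    MeasurableSet (wellDefined P h m j) := by
  rw [wellDefined_eq_iUnion]
  exact Finset.measurableSet_biUnion _ fun u _ =>
    (measurableSet_isDefining u).prod (measurableSet_topDefined hP hε hm)

/-- Markov's inequality for the expected coverage. -/
theorem WellDistributed.queryLaw_bad_le (hP : WellDistributed ε P) (hε : 0 < ε) (hk : 1 ≤ k)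
    (D : SumFamily P) (hj : ∀ i, 1 ≤ j i) (hC : 2 ≤ C) (hCε : ⌈1 / ε⌉₊ < C) (hm : 0 < m)
    (hn : 0 < P.card) {b : ℝ} (hb : 0 < b) :
    queryLaw k (wellDefined P (height P.card) m j ∩
      {q | ¬ ∃ u, IsDefining (height P.card) j q.1 u ∧
        expectedCoverage D (height P.card) m C j q.1 u < ENNReal.ofReal b}) ≤
      ENNReal.ofReal (D.storage * (4 * 12 ^ k * m ^ 2 * (∏ i, (j i : ℝ)) /
        (ε ^ 3 * P.card * (height P.card : ℝ) ^ k)) / b) := by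
  classical
  set h := height P.card with hh
  have hh0 : 0 < h := Nat.succ_pos _
  set F : (Fin k → Node) → ℝ := fun u => ∑ s ∈ D.sums.filter (fun s => s.card ≠ 1),
        coverBound ε h P.card m j u s * topHeight ε P.card m u with hF
  have hF0 : ∀ u, 0 ≤ F u := fun u => Finset.sum_nonneg fun s _ =>
    mul_nonneg (coverBound_nonneg hε _ s) (topHeight_pos hε hn hm).le
  set U := Fintype.piFinset (fun _ : Fin k => nodes h) with hU
  -- Failure of the coverage bound depends on ω only through `u`, and for a bad `u` the measure of
  -- the admissible y is at most F(u)/b. So the normalisation of the conditional law of y cancels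
  -- against the measure of the bad event.
  set B := U.filter (fun u => yLaw {y | TopDefined P u y m} ≤ ENNReal.ofReal (F u / b)) with hB
  have hsub : (wellDefined P h m j ∩
      {q | ¬ ∃ u, IsDefining h j q.1 u ∧
        expectedCoverage D h m C j q.1 u < ENNReal.ofReal b}) ⊆
      ⋃ u ∈ B, {ω | IsDefining h j ω u} ×ˢ {y | TopDefined P u y m} := by
    rintro ⟨ω, y⟩ ⟨⟨u, hu, ht⟩, hbad⟩
    simp only [Set.mem_iUnion, Set.mem_prod, exists_prop]
    refine ⟨u, ?_, hu, ht⟩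
    refine Finset.mem_filter.2 ⟨Fintype.mem_piFinset.2 fun i => mem_nodes (hu i).1, ?_⟩
    have h1 : ENNReal.ofReal b ≤ expectedCoverage D h m C j ω u := by
      by_contra! hlt
      exact hbad ⟨u, hu, hlt⟩
    rw [expectedCoverage, hu.setOf_wellDefined, ProbabilityTheory.cond, lintegral_smul_measure, smul_eq_mul] at h1
    have h2 := h1.trans (mul_le_mul' le_rfl
      (hP.setLIntegral_coverage_le hε hk D hj hC hCε hm hn hu))
    rw [← ENNReal.div_eq_inv_mul] at h2
    rw [ENNReal.ofReal_div_of_pos hb]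
    rw [ENNReal.le_div_iff_mul_le (Or.inl (by simpa using hb)) (Or.inl ENNReal.ofReal_ne_top)]
    -- Valid also when the top is defined for almost no y, as `ENNReal.mul_div_le` allows division
    -- by zero.
    exact (mul_le_mul' le_rfl h2).trans ENNReal.mul_div_le
  refine (measure_mono hsub).trans ((measure_biUnion_finset_le _ _).trans ?_)
  have hprod : ∀ u : Fin k → Node, (0 : ℝ) ≤ ∏ i, ((2 : ℝ) ^ (u i).depth)⁻¹ / h :=
    fun u => Finset.prod_nonneg fun i _ => by positivity
  have h3 : ∀ u ∈ B, queryLaw k ({ω | IsDefining h j ω u} ×ˢ {y | TopDefined P u y m}) ≤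
      ENNReal.ofReal ((∏ i, ((2 : ℝ) ^ (u i).depth)⁻¹ / h) * (F u / b)) := by
    intro u hu
    rw [queryLaw, Measure.prod_prod, ENNReal.ofReal_mul (hprod u)]
    exact mul_le_mul' (diagramLaw_isDefining_le hh0 u) (Finset.mem_filter.1 hu).2
  refine (Finset.sum_le_sum h3).trans ?_
  rw [← ENNReal.ofReal_sum_of_nonneg fun u _ => mul_nonneg (hprod u) (div_nonneg (hF0 u) hb.le)]
  refine ENNReal.ofReal_le_ofReal ?_
  refine (Finset.sum_le_sum_of_subset_of_nonneg (Finset.filter_subset _ U)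
    fun u _ _ => mul_nonneg (hprod u) (div_nonneg (hF0 u) hb.le)).trans ?_
  simp only [← mul_div_assoc]
  rw [← Finset.sum_div]
  refine div_le_div_of_nonneg_right ?_ hb.le
  simp only [hF, Finset.mul_sum]
  rw [Finset.sum_comm]
  refine (Finset.sum_le_sum fun s _ => sum_coverBound_le hε hn hj s).trans (le_of_eq ?_)
  rw [Finset.sum_const, nsmul_eq_mul, SumFamily.storage]
  ring

end Markov

/-! ### Lower bound for the probability of being well-defined -/

section WellDefined

/-- Translation by 2^{-D} takes even cells to odd ones, so the odd set and one translate of it cover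
[0,1). As 2^D is even, the last cell is odd and no even cell leaves the interval. -/
theorem half_le_volume_odd_floor {D : ℕ} (hD : 1 ≤ D) :
    ENNReal.ofReal (1 / 2) ≤ volume {x : ℝ | x ∈ Set.Ico 0 1 ∧ Odd ⌊x * 2 ^ D⌋₊} := by
  set O := {x : ℝ | x ∈ Set.Ico 0 1 ∧ Odd ⌊x * 2 ^ D⌋₊} with hO
  have h2 : (0 : ℝ) < 2 ^ D := by positivity
  have hsub : Set.Ico (0 : ℝ) 1 ⊆ O ∪ (fun x => x + (2 ^ D)⁻¹) ⁻¹' O := by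
    intro x hx
    rcases Nat.even_or_odd ⌊x * 2 ^ D⌋₊ with he | ho
    · right
      have hx0 : 0 ≤ x * 2 ^ D := mul_nonneg hx.1 h2.le
      have e : (x + (2 ^ D)⁻¹) * 2 ^ D = x * 2 ^ D + 1 := by field_simp
      refine ⟨⟨add_nonneg hx.1 (by positivity), ?_⟩, ?_⟩
      · have h3 : ⌊x * 2 ^ D⌋₊ < 2 ^ D := by
          rw [Nat.floor_lt hx0]; push_cast; nlinarith [hx.2]
        have h4 : Even (2 ^ D) := (even_two).pow_of_ne_zero (by omega)
        have h5 : ⌊x * 2 ^ D⌋₊ + 2 ≤ 2 ^ D := by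
          obtain ⟨a, ha⟩ := he
          obtain ⟨b, hb⟩ := h4
          omega
        have h6 : ((⌊x * 2 ^ D⌋₊ : ℝ) + 2) ≤ 2 ^ D := by exact_mod_cast h5
        have h7 := Nat.lt_floor_add_one (x * 2 ^ D)
        refine lt_of_mul_lt_mul_right ?_ h2.le
        rw [e]; linarith
      · rw [e, Nat.floor_add_one hx0]; exact he.add_one
    · exact Or.inl ⟨hx, ho⟩
  have h1 := (measure_mono (μ := volume) hsub).trans (measure_union_le _ _)
  rw [measure_preimage_add_right, Real.volume_Ico, sub_zero, ← two_mul] at h1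
  rw [ENNReal.ofReal_div_of_pos two_pos]
  refine ENNReal.div_le_of_le_mul' ?_
  simpa using h1

variable {k : ℕ}

/-- The points of the representative diagram with `z ≥ 1 - a` for which the node of depth
`l + j`, where `l` is the depth given by `z`, is a right child. -/
def goodSquare (h j : ℕ) (a : ℝ) : Set (ℝ × ℝ) :=
  {p | p.1 ∈ Set.Ico 0 1 ∧ Odd ⌊p.1 * 2 ^ (⌊(1 - p.2) * h⌋₊ + j)⌋₊ ∧ p.2 ∈ Set.Icc (1 - a) 1}

theorem measurableSet_goodSquare (h j : ℕ) (a : ℝ) : MeasurableSet (goodSquare h j a) := by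
  have hf : Measurable fun p : ℝ × ℝ => ⌊p.1 * 2 ^ (⌊(1 - p.2) * h⌋₊ + j)⌋₊ := by
    refine Nat.measurable_floor.comp (measurable_fst.mul ?_)
    exact (measurable_from_nat (f := fun l => (2 : ℝ) ^ (l + j))).comp
      ((measurable_nodeAt_depth h).comp measurable_snd)
  exact (measurable_fst measurableSet_Ico).inter
    ((hf (MeasurableSet.of_discrete (s := {l | Odd l}))).inter (measurable_snd measurableSet_Icc))

theorem volume_goodSquare_ge (h : ℕ) {j : ℕ} (hj : 1 ≤ j) {a : ℝ} (ha1 : a ≤ 1) :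
    ENNReal.ofReal (a / 2) ≤
      (volume.restrict (Set.Icc (0 : ℝ) 1 ×ˢ Set.Icc (0 : ℝ) 1)) (goodSquare h j a) := by
  have hsub : goodSquare h j a ⊆ Set.Icc (0 : ℝ) 1 ×ˢ Set.Icc (0 : ℝ) 1 := fun p hp =>
    ⟨⟨hp.1.1, hp.1.2.le⟩, by linarith [hp.2.2.1], hp.2.2.2⟩
  rw [Measure.restrict_apply (measurableSet_goodSquare h j a), Set.inter_eq_left.2 hsub,
    Measure.volume_eq_prod, Measure.prod_apply_symm (measurableSet_goodSquare h j a)]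
  calc ENNReal.ofReal (a / 2)
      = ∫⁻ _ in Set.Icc (1 - a) 1, ENNReal.ofReal (1 / 2) := by
        rw [setLIntegral_const, Real.volume_Icc, ← ENNReal.ofReal_mul (by norm_num)]
        congr 1; ring
    _ ≤ ∫⁻ z in Set.Icc (1 - a) 1, volume ((fun x => (x, z)) ⁻¹' goodSquare h j a) := by
        refine setLIntegral_mono' measurableSet_Icc fun z hz => ?_
        refine (half_le_volume_odd_floor (D := ⌊(1 - z) * h⌋₊ + j) (by omega)).trans
          (measure_mono fun x hx => ⟨hx.1, hx.2, hz⟩)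
    _ ≤ _ := setLIntegral_le_lintegral _ _

theorem exists_isDefining {h : ℕ} {j : Fin k → ℕ} {a : ℝ} {ω : Fin k → ℝ × ℝ}
    (hω : ∀ i, ω i ∈ goodSquare h (j i) a) (hd : ∀ i, ⌊(1 - (ω i).2) * h⌋₊ + j i ≤ h) :
    ∃ u, IsDefining h j ω u ∧ ∀ i, (u i).depth = ⌊(1 - (ω i).2) * h⌋₊ + j i := by
  -- The cell of x_i has odd index, so the index one less belongs to its left sibling.
  refine ⟨fun i => ⟨⌊(1 - (ω i).2) * h⌋₊ + j i,
    ⌊(ω i).1 * 2 ^ (⌊(1 - (ω i).2) * h⌋₊ + j i)⌋₊ - 1⟩, fun i => ?_, fun i => rfl⟩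
  obtain ⟨hx, ho, -⟩ := hω i
  have hpos : 0 < ⌊(ω i).1 * 2 ^ (⌊(1 - (ω i).2) * h⌋₊ + j i)⌋₊ := ho.pos
  have h2 : (0 : ℝ) < 2 ^ (⌊(1 - (ω i).2) * h⌋₊ + j i) := by positivity
  have hlt : ⌊(ω i).1 * 2 ^ (⌊(1 - (ω i).2) * h⌋₊ + j i)⌋₊ <
      2 ^ (⌊(1 - (ω i).2) * h⌋₊ + j i) := by
    rw [Nat.floor_lt (mul_nonneg hx.1 h2.le)]; push_cast; nlinarith [hx.2]
  refine ⟨⟨hd i, ?_⟩, rfl, Nat.Odd.sub_odd ho odd_one, ⟨hd i, ?_⟩, ?_⟩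
  · exact (Nat.sub_le _ 1).trans_lt hlt
  · exact (Nat.sub_add_cancel hpos).trans_lt hlt
  · rw [Node.mem_cell_iff_floor hx.1]
    exact (Nat.sub_add_cancel hpos).symm

variable {ε : ℝ} {P : Finset (Pt k)} {m : ℕ}

theorem WellDistributed.topDefined (hP : WellDistributed ε P) (hε : 0 < ε) (hm : 0 < m) {h : ℕ}
    {u : Fin k → Node} (hu : ∀ i, (u i).InTree h) {y : ℝ} (hy : 1 / 2 ≤ y) (hy1 : y ≤ 1)
    (hle : m * ∏ i, (2 : ℝ) ^ ((u i).depth + 1) ≤ ε * P.card / 2) : TopDefined P u y m := by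
  rw [topDefined_iff hP hε hm]
  have key := hP.le_card (fun i => (u i).left, 0) (fun i => (u i).mid, y)
    (fun i => (u i).left_lt_mid) (by show (0 : ℝ) < y; linarith)
    (left_mem_unitCube hu le_rfl zero_le_one) (mid_mem_unitCube hu (by linarith) hy1)
  refine (Nat.le_floor ?_).trans (key.trans (Finset.card_le_card (pointsIn_mono fun p hp hr =>
    ⟨hp, fun i => ⟨(hr.1 i).1, lt_of_le_of_lt (hr.1 i).2 (u i).mid_lt_right⟩, hr.2.2⟩)))
  rw [rectVol_left_mid]
  have hp : (0 : ℝ) < ∏ i, (2 : ℝ) ^ ((u i).depth + 1) := by positivity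
  rw [← le_div_iff₀ hp] at hle
  refine hle.trans ?_
  have h0 : 0 ≤ ε * P.card * (∏ i, (2 : ℝ) ^ ((u i).depth + 1))⁻¹ := by positivity
  rw [sub_zero, div_eq_mul_inv]
  nlinarith

theorem two_pow_floor_le {n : ℕ} (hn : 0 < n) {a z : ℝ} (hz : 1 - a ≤ z) (hz1 : z ≤ 1) :
    (2 : ℝ) ^ ⌊(1 - z) * height n⌋₊ ≤ (2 * n : ℝ) ^ a := by
  have h1 : (⌊(1 - z) * height n⌋₊ : ℝ) ≤ height n * a := by
    refine (Nat.floor_le (mul_nonneg (by linarith) (Nat.cast_nonneg _))).trans ?_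
    rw [mul_comm]
    exact mul_le_mul_of_nonneg_left (by linarith) (Nat.cast_nonneg _)
  have h2 : (2 : ℝ) ^ height n ≤ 2 * n := by
    rw [height, pow_succ, mul_comm]
    have : (2 : ℝ) ^ Nat.log 2 n ≤ n := by exact_mod_cast Nat.pow_log_le_self 2 hn.ne'
    linarith
  calc (2 : ℝ) ^ ⌊(1 - z) * height n⌋₊ = (2 : ℝ) ^ (⌊(1 - z) * height n⌋₊ : ℝ) :=
        (Real.rpow_natCast _ _).symm
    _ ≤ (2 : ℝ) ^ (height n * a) := Real.rpow_le_rpow_of_exponent_le one_le_two h1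
    _ = ((2 : ℝ) ^ height n) ^ a := by rw [Real.rpow_mul two_pos.le, Real.rpow_natCast]
    _ ≤ (2 * n : ℝ) ^ a := Real.rpow_le_rpow (by positivity) h2 (by linarith)

/-- Per axis, z_i ≥ 1 - a costs a factor a and the parity condition a factor 1/2; y ≥ 1/2 costs
another 1/2. Shallowness gives 2^{depth(v_i)} ≤ (2n)^a, so r(u) is large enough to contain m points
below y. -/
theorem WellDistributed.queryLaw_wellDefined_ge (hP : WellDistributed ε P) (hε : 0 < ε)
    (hm : 0 < m) (hn : 0 < P.card) {j : Fin k → ℕ}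
    (hj : ∀ i, 1 ≤ j i ∧ (j i : ℝ) ≤ (height P.card : ℝ) / 2) {a : ℝ} (ha : 0 < a)
    (ha1 : a ≤ 1 / 2)
    (hle : m * 2 ^ (∑ i, j i) * (2 ^ (k + 1) * ((2 * P.card : ℝ) ^ a) ^ k) ≤ ε * P.card) :
    ENNReal.ofReal ((a / 2) ^ k * (1 / 2)) ≤ queryLaw k (wellDefined P (height P.card) m j) := by
  have hsub : (Set.pi Set.univ fun i => goodSquare (height P.card) (j i) a) ×ˢ
      Set.Icc (1 / 2 : ℝ) 1 ⊆ wellDefined P (height P.card) m j := by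
    rintro ⟨ω, y⟩ ⟨hω, hy⟩
    have hω' : ∀ i, ω i ∈ goodSquare (height P.card) (j i) a := fun i => hω i trivial
    have hd : ∀ i, ⌊(1 - (ω i).2) * height P.card⌋₊ + j i ≤ height P.card := fun i => by
      have h1 : (⌊(1 - (ω i).2) * height P.card⌋₊ : ℝ) ≤ (height P.card : ℝ) / 2 := by
        have h3 := (hω' i).2.2
        refine (Nat.floor_le (mul_nonneg (by linarith [h3.2]) (Nat.cast_nonneg _))).trans ?_
        have : (0 : ℝ) ≤ height P.card := Nat.cast_nonneg _
        nlinarith [h3.1]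
      have h2 := (hj i).2
      have : (⌊(1 - (ω i).2) * height P.card⌋₊ : ℝ) + j i ≤ height P.card := by linarith
      exact_mod_cast this
    obtain ⟨u, hu, hud⟩ := exists_isDefining hω' hd
    refine ⟨u, hu, hP.topDefined hε hm (fun i => (hu i).1) hy.1 hy.2 ?_⟩
    have h4 : ∏ i, (2 : ℝ) ^ ((u i).depth + 1) ≤
        ∏ i, ((2 * P.card : ℝ) ^ a * (2 ^ j i * 2)) := by
      refine Finset.prod_le_prod (fun i _ => by positivity) fun i _ => ?_
      rw [hud i, pow_succ, pow_add, mul_assoc]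
      exact mul_le_mul_of_nonneg_right (two_pow_floor_le hn (hω' i).2.2.1 (hω' i).2.2.2)
        (by positivity)
    refine (mul_le_mul_of_nonneg_left h4 (Nat.cast_nonneg m)).trans ?_
    simp only [Finset.prod_mul_distrib, Finset.prod_const, Finset.card_univ, Fintype.card_fin,
      Finset.prod_pow_eq_pow_sum]
    rw [pow_succ] at hle
    linarith
  refine le_trans ?_ (measure_mono hsub)
  rw [queryLaw, Measure.prod_prod, diagramLaw, Measure.pi_pi, ENNReal.ofReal_mul (by positivity)]
  refine mul_le_mul' ?_ ?_
  · calc ENNReal.ofReal ((a / 2) ^ k) = ∏ _i : Fin k, ENNReal.ofReal (a / 2) := by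
          rw [Finset.prod_const, Finset.card_univ, Fintype.card_fin,
            ENNReal.ofReal_pow (by positivity)]
      _ ≤ _ := Finset.prod_le_prod' fun i _ =>
          volume_goodSquare_ge _ (hj i).1 (by linarith)
  · rw [yLaw, Measure.restrict_apply measurableSet_Icc, Set.Icc_inter_Icc]
    norm_num

/-- Half of the slack n^α pays for the depths of the v_i, the other half absorbs the constants for
large n. -/
theorem exists_forall_rpow_le (k : ℕ) {α ε : ℝ} (hα : 0 < α) (hε : 0 < ε) :
    ∃ n₀ : ℕ, ∀ n : ℕ, n₀ ≤ n → 0 < n →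
      (n : ℝ) ^ (1 - α) * (2 ^ (k + 1) * (2 * n : ℝ) ^ (α / 2)) ≤ ε * n := by
  have ht : Filter.Tendsto (fun n : ℕ => (n : ℝ) ^ (α / 2)) Filter.atTop Filter.atTop :=
    (tendsto_rpow_atTop (half_pos hα)).comp tendsto_natCast_atTop_atTop
  obtain ⟨n₀, hn₀⟩ := Filter.eventually_atTop.1
    (ht.eventually_ge_atTop ((2 : ℝ) ^ (k + 1) * 2 ^ (α / 2) / ε))
  refine ⟨n₀, fun n hn hpos => ?_⟩
  have h0 : (0 : ℝ) < n := by exact_mod_cast hpos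
  have h1 := hn₀ n hn
  rw [div_le_iff₀ hε] at h1
  have e1 : (n : ℝ) ^ (1 - α) * n ^ (α / 2) * n ^ (α / 2) = n := by
    rw [← Real.rpow_add h0, ← Real.rpow_add h0]
    ring_nf
    exact Real.rpow_one _
  have h2 : 0 ≤ (n : ℝ) ^ (1 - α) * n ^ (α / 2) := by positivity
  calc (n : ℝ) ^ (1 - α) * (2 ^ (k + 1) * (2 * n : ℝ) ^ (α / 2))
      = ((n : ℝ) ^ (1 - α) * n ^ (α / 2)) * (2 ^ (k + 1) * 2 ^ (α / 2)) := by
        rw [Real.mul_rpow two_pos.le h0.le]; ring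
    _ ≤ ((n : ℝ) ^ (1 - α) * n ^ (α / 2)) * (n ^ (α / 2) * ε) := mul_le_mul_of_nonneg_left h1 h2
    _ = ((n : ℝ) ^ (1 - α) * n ^ (α / 2) * n ^ (α / 2)) * ε := by ring
    _ = ε * n := by rw [e1]; ring

end WellDefined

/-! ### Tops with fewer than C points -/

section SmallTop

variable {k h : ℕ} {P : Finset (Pt k)} {j : Fin k → ℕ} {ω : Fin k → ℝ × ℝ}
  {u : Fin k → Node} {m C : ℕ}

theorem card_topSet_le (P : Finset (Pt k)) (u : Fin k → Node) (y : ℝ) (m : ℕ) :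
    (topSet P u y m).card ≤ m := by
  by_cases H : TopDefined P u y m
  · rw [topSet, dif_pos H, H.choose_spec.2]
  · rw [topSet, dif_neg H]; simp

theorem expectedCoverage_eq_zero (D : SumFamily P) (hmC : m < C) :
    expectedCoverage D h m C j ω u = 0 := by
  have : ∀ y, coverage D h m C ω y u = 0 := fun y => by
    classical
    rw [coverage, Finset.sum_eq_zero]
    intro s hs
    rw [coveringSums, Finset.mem_filter] at hs
    have h1 : (pointsIn (topSet P u y m) (ext h s u)).card ≤ (topSet P u y m).card :=
      Finset.card_le_card fun p hp => (mem_pointsIn.1 hp).1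
    have h2 := card_topSet_le P u y m
    omega
  simp [expectedCoverage, this]

end SmallTop

end RangeLB

/-! ### Choice of constants and conclusion -/

theorem mainTheorem3 (k : ℕ) (hk : 1 ≤ k) :
    ∃ K : ℝ, 0 < K ∧ ∀ α : ℝ, 0 < α → ∃ c : ℝ, 0 < c ∧
      ∀ ε : ℝ, 0 < ε → ∃ C₀ : ℕ, ∀ C : ℕ, C₀ ≤ C → ∀ C' : ℝ, 0 < C' →
        ∃ δ₀ : ℝ, 0 < δ₀ ∧ ∃ n₀ : ℕ, ∀ δ : ℝ, 0 < δ → δ ≤ δ₀ →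
          ∀ P : Finset (RangeLB.Pt k), n₀ ≤ P.card → RangeLB.WellDistributed ε P →
          ∀ D : RangeLB.SumFamily P, 0 < D.storage →
          ∀ j : Fin k → ℕ, (∀ i, 1 ≤ j i ∧ (j i : ℝ) ≤ (RangeLB.height P.card : ℝ) / 2) →
            (RangeLB.topSize δ D j : ℝ) * 2 ^ (∑ i, j i) ≤ (P.card : ℝ) ^ (1 - α) →
            ENNReal.ofReal c ≤ RangeLB.queryLaw k
              (RangeLB.wellDefined P (RangeLB.height P.card) (RangeLB.topSize δ D j) j) ∧
            ProbabilityTheory.cond (RangeLB.queryLaw k)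
              (RangeLB.wellDefined P (RangeLB.height P.card) (RangeLB.topSize δ D j) j)
              {q | ¬ ∃ u, RangeLB.IsDefining (RangeLB.height P.card) j q.1 u ∧
                RangeLB.expectedCoverage D (RangeLB.height P.card) (RangeLB.topSize δ D j) C j q.1 u
                  < ENNReal.ofReal ((RangeLB.topSize δ D j : ℝ) / C')}
              ≤ ENNReal.ofReal (K * Real.sqrt (δ / ε)) := by
  have hk0 : (0 : ℝ) < k := by exact_mod_cast hk
  refine ⟨1, one_pos, fun α hα => ?_⟩
  -- The first bound makes (2n)^{ak} ≤ (2n)^{α/2}; the second keeps depth(v_i) ≤ h/2, so that j_i ≤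
  -- h/2 leaves u_i inside the tree.
  set a : ℝ := min (α / (2 * k)) (1 / 2) with ha
  have ha0 : 0 < a := lt_min (by positivity) (by norm_num)
  have hak : a * k ≤ α / 2 := by
    have : a ≤ α / (2 * k) := min_le_left _ _
    refine (mul_le_mul_of_nonneg_right this hk0.le).trans (le_of_eq ?_)
    field_simp
  set c : ℝ := (a / 2) ^ k * (1 / 2) with hc
  have hc0 : 0 < c := by positivity
  -- C ≥ 2 is needed for the density bound on covered points, and C > ⌈1/ε⌉ excludes singletons.
  refine ⟨c, hc0, fun ε hε => ⟨max 2 (⌈1 / ε⌉₊ + 1), fun C hC C' hC' => ?_⟩⟩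
  obtain ⟨n₀, hn₀⟩ := RangeLB.exists_forall_rpow_le k hα hε
  set A : ℝ := 8 * 12 ^ k * C' / ε ^ 3 with hA
  have hA0 : 0 < A := by positivity
  -- This δ₀ is the solution of Aδ = c√(δ/ε).
  refine ⟨(c / A) ^ 2 / ε, by positivity, max 1 n₀, ?_⟩
  intro δ hδ hδ₀ P hPn hP D hD j hj hm
  set m := RangeLB.topSize δ D j with hmd
  have hn : 0 < P.card := (le_max_left _ _).trans hPn
  have hn' : (0 : ℝ) < P.card := by exact_mod_cast hn
  have hD' : (0 : ℝ) < D.storage := by exact_mod_cast hD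
  have hh : (0 : ℝ) < RangeLB.height P.card := by exact_mod_cast Nat.succ_pos _
  have hj0 : (0 : ℝ) < ∏ i, (j i : ℝ) := Finset.prod_pos fun i _ => by exact_mod_cast (hj i).1
  have hlam : 0 < RangeLB.lam δ D j := by rw [RangeLB.lam]; positivity
  have hm0 : 0 < m := Nat.ceil_pos.2 hlam
  have hm0' : (0 : ℝ) < m := by exact_mod_cast hm0
  have hWD : ENNReal.ofReal c ≤ RangeLB.queryLaw k
      (RangeLB.wellDefined P (RangeLB.height P.card) m j) := by
    refine hP.queryLaw_wellDefined_ge hε hm0 hn hj ha0 (min_le_right _ _) ?_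
    refine le_trans ?_ (hn₀ P.card ((le_max_right _ _).trans hPn) hn)
    refine mul_le_mul hm ?_ (by positivity) (by positivity)
    refine mul_le_mul_of_nonneg_left ?_ (by positivity)
    rw [← Real.rpow_natCast, ← Real.rpow_mul (by positivity)]
    refine Real.rpow_le_rpow_of_exponent_le ?_ hak
    have : (1 : ℝ) ≤ P.card := by exact_mod_cast hn
    linarith
  refine ⟨hWD, ?_⟩
  rw [ProbabilityTheory.cond_apply (RangeLB.measurableSet_wellDefined hP hε hm0), one_mul]
  have hC2 : 2 ≤ C := (le_max_left _ _).trans hC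
  have hCε : ⌈1 / ε⌉₊ < C := (le_max_right _ _).trans hC
  -- If m < C, nothing covers C points and the coverage vanishes. Otherwise m ≥ 2, so rounding λ up
  -- to m at most doubles it.
  rcases lt_or_ge m C with hmC | hmC
  · have : RangeLB.wellDefined P (RangeLB.height P.card) m j ∩
        {q | ¬ ∃ u, RangeLB.IsDefining (RangeLB.height P.card) j q.1 u ∧
          RangeLB.expectedCoverage D (RangeLB.height P.card) m C j q.1 u <
            ENNReal.ofReal ((m : ℝ) / C')} = ∅ := by
      refine Set.eq_empty_of_forall_notMem ?_
      rintro q ⟨⟨u, hu, -⟩, hbad⟩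
      refine hbad ⟨u, hu, ?_⟩
      rw [RangeLB.expectedCoverage_eq_zero D hmC, ENNReal.ofReal_pos]
      positivity
    rw [this, measure_empty, mul_zero]
    exact zero_le
  · have hm2 : (m : ℝ) ≤ 2 * RangeLB.lam δ D j := by
      have h1 : (m : ℝ) < RangeLB.lam δ D j + 1 := Nat.ceil_lt_add_one hlam.le
      have h2 : (2 : ℝ) ≤ m := by exact_mod_cast hC2.trans hmC
      linarith
    have hbad := hP.queryLaw_bad_le hε hk D (fun i => (hj i).1) hC2 hCε hm0 hn
      (div_pos hm0' hC')
    rw [← ENNReal.div_eq_inv_mul]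
    refine ENNReal.div_le_of_le_mul' ((hbad.trans ?_).trans (mul_le_mul' hWD le_rfl))
    rw [← ENNReal.ofReal_mul hc0.le]
    refine ENNReal.ofReal_le_ofReal ?_
    have h1 : (D.storage : ℝ) * (4 * 12 ^ k * m ^ 2 * (∏ i, (j i : ℝ)) /
        (ε ^ 3 * P.card * (RangeLB.height P.card : ℝ) ^ k)) / (m / C') =
        4 * 12 ^ k * C' / ε ^ 3 * δ * (m / RangeLB.lam δ D j) := by
      rw [RangeLB.lam]; field_simp
    have h2 : (m : ℝ) / RangeLB.lam δ D j ≤ 2 := (div_le_iff₀ hlam).2 hm2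
    have h3 : A * Real.sqrt δ ≤ c / Real.sqrt ε := by
      have := Real.sqrt_le_sqrt hδ₀
      rw [Real.sqrt_div (sq_nonneg _), Real.sqrt_sq (by positivity)] at this
      calc A * Real.sqrt δ ≤ A * (c / A / Real.sqrt ε) := mul_le_mul_of_nonneg_left this hA0.le
        _ = c / Real.sqrt ε := by field_simp
    rw [h1]
    calc 4 * 12 ^ k * C' / ε ^ 3 * δ * (m / RangeLB.lam δ D j)
        ≤ 4 * 12 ^ k * C' / ε ^ 3 * δ * 2 := mul_le_mul_of_nonneg_left h2 (by positivity)
      _ = A * Real.sqrt δ * Real.sqrt δ := by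
          rw [mul_assoc A, Real.mul_self_sqrt hδ.le, hA]; ring
      _ ≤ c / Real.sqrt ε * Real.sqrt δ := mul_le_mul_of_nonneg_right h3 (Real.sqrt_nonneg _)
      _ = c * Real.sqrt (δ / ε) := by rw [Real.sqrt_div hδ.le]; ring
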